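/- For $\varepsilon>0$ and a continuous function $\sigma:[0,1]\to(0,\infty)$, let $\mathbb P^{\sigma,\varepsilon}$ denote the law of the observation $$dY_t=\Bigl(\int_0^t\sigma(s)\,dB_s\Bigr)dt+\varepsilon\,dW_t,\qquad t\in[0,1],$$ where $B$ and $W$ are independent standard Brownian motions; that is, $\mathbb P^{\sigma,\varepsilon}$ is the law, on $\mathbb R^{L^2([0,1])}$ with its product Borel $\sigma$-algebra, of the family $$Y_f=\int_0^1 f(t)\Bigl(\int_0^t\sigma(s)\,dB_s\Bigr)dt+\varepsilon\int_0^1 f(t)\,dW_t,\qquad f\in L^2([0,1]).$$ For probability measures $P,Q$ with densities $p,q$ with respect to a dominating measure $\mu$ (for instance $\mu=P+Q$), let $H(P,Q)=\bigl(\int(\sqrt p-\sqrt q)^2\,d\mu\bigr)^{1/2}$ be the Hellinger distance. Then there is a universal constant $C>0$ such that for all $\varepsilon>0$ and all continuous $\sigma_1,\sigma_2:[0,1]\to(0,\infty)$ $$H(\mathbb P^{\sigma_1,\varepsilon},\mathbb P^{\sigma_2,\varepsilon})\le C\,\|\sigma_1^2-\sigma_2^2\|_\infty\Bigl(\max_{t\in[0,1]}\sigma_1(t)^{-3/2}\Bigr)\varepsilon^{-1/2}.$$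 Moreover, for every $M>0$ there is a constant $C_M>0$, depending only on $M$, such that for all $\varepsilon>0$ and all continuous $\sigma_1,\sigma_2:[0,1]\to(0,\infty)$ with $\min_{t\in[0,1]}\sigma_1(t)\le M$ $$H(\mathbb P^{\sigma_1,\varepsilon},\mathbb P^{\sigma_2,\varepsilon})\le C_M\,\|\sigma_1^2-\sigma_2^2\|_\infty\Bigl(\max_{t\in[0,1]}\sigma_1(t)^{-3}\Bigr)\varepsilon^{-1/2}.$$ -/

import Mathlib

open MeasureTheory ProbabilityTheory Filter Topology
open scoped NNReal ENNReal

universe u v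

noncomputable section

namespace WhiteNoise

/-- The Hilbert space `L²([0,1])` with respect to Lebesgue measure. -/
abbrev L2I : Type := Lp ℝ 2 (volume : Measure unitInterval)

/-- A step function `∑ i < n, aᵢ 1_{(sᵢ, tᵢ]}` on `[0,1]`. The intervals may overlap. -/
structure StepFun where
  n : ℕ
  a : Fin n → ℝ
  s : Fin n → unitInterval
  t : Fin n → unitInterval
  s_le_t : ∀ i, s i ≤ t i

/-- The step function as a function on `[0,1]`. -/
def StepFun.toFun (φ : StepFun) (x : unitInterval) : ℝ :=
  ∑ i, (Set.Ioc (φ.s i) (φ.t i)).indicator (fun _ => φ.a i) x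

/-- The elementary stochastic integral `∑ i < n, aᵢ (B_{tᵢ} - B_{sᵢ})` of a step function. -/
def StepFun.integral {Ω : Type*} (φ : StepFun) (B : ℝ≥0 → Ω → ℝ) (ω : Ω) : ℝ :=
  ∑ i, φ.a i * (B (unitInterval.toNNReal (φ.t i)) ω - B (unitInterval.toNNReal (φ.s i)) ω)

/-- `Z` is (a version of) the Wiener integral `∫₀¹ g dB` of the deterministic square integrable
function `g`: the limit in `L²(P)` of the elementary integrals of step functions that converge
to `g` in `L²([0,1])`. For a Brownian motion `B`, the Itô isometry shows that such a `Z` exists,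
does not depend on the approximating sequence, and is unique up to `P`-null sets. -/
def IsWienerIntegral {Ω : Type*} [MeasurableSpace Ω] (P : Measure Ω) (B : ℝ≥0 → Ω → ℝ)
    (g : unitInterval → ℝ) (Z : Ω → ℝ) : Prop :=
  MemLp g 2 (volume : Measure unitInterval) ∧ MemLp Z 2 P ∧
  ∃ φ : ℕ → StepFun,
    Tendsto (fun k => eLpNorm (fun x => (φ k).toFun x - g x) 2 (volume : Measure unitInterval))
      atTop (𝓝 0) ∧
    Tendsto (fun k => eLpNorm (fun ω => (φ k).integral B ω - Z ω) 2 P) atTop (𝓝 0)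

/-- On the probability space `(Ω, P)`, the family `Y = (Y_f)`, `f ∈ L²([0,1])`, is the observation
`dY_t = X_t dt + ε dW_t`, `X_t = ∫₀ᵗ σ(s) dB_s`, `t ∈ [0,1]`, with independent standard Brownian
motions `B` and `W`, realized as the random variables
`Y_f = ∫₀¹ f(t) X_t dt + ε ∫₀¹ f(t) dW_t`. Here `X` is the continuous version of the
stochastic integral process, so that `∫₀¹ f(t) X_t dt` is a pathwise Lebesgue integral. -/
structure IsObservation {Ω : Type*} [MeasurableSpace Ω] (P : Measure Ω) (σ : C(unitInterval, ℝ)) (ε : ℝ)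
    (B W : ℝ≥0 → Ω → ℝ) (X : unitInterval → Ω → ℝ) (Y : L2I → Ω → ℝ) : Prop where
  brownian_B : IsBrownianReal B P
  brownian_W : IsBrownianReal W P
  indep : IndepFun (fun ω t => B t ω) (fun ω t => W t ω) P
  signal : ∀ t, IsWienerIntegral P B ((Set.Iic t).indicator σ) (X t)
  signal_continuous : ∀ᵐ ω ∂P, Continuous (fun t => X t ω)
  measurable_obs : ∀ f, Measurable (Y f)
  obs : ∀ f : L2I, ∃ Z : Ω → ℝ, IsWienerIntegral P W f Z ∧
    ∀ᵐ ω ∂P, Y f ω = (∫ t, f t * X t ω) + ε * Z ω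

/-- `Q` is the law `P^{σ,ε}` of the observation `Y` for some (equivalently, every) choice of the
Brownian motions `B` and `W`; it is a measure on `ℝ^{L²([0,1])}` with its product Borel
σ-algebra. -/
def IsObservationLaw (σ : C(unitInterval, ℝ)) (ε : ℝ) (Q : Measure (L2I → ℝ)) : Prop :=
  ∃ (Ω : Type u) (_ : MeasurableSpace Ω) (P : Measure Ω) (B W : ℝ≥0 → Ω → ℝ)
    (X : unitInterval → Ω → ℝ) (Y : L2I → Ω → ℝ),
    IsObservation P σ ε B W X Y ∧ Q = P.map (fun ω f => Y f ω)

/-- The Hellinger distance `(∫ (√p - √q)² dμ)^{1/2}`, where `p` and `q` are the densities of `P`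
and `Q` with respect to the dominating measure `μ = P + Q`. -/
def hellingerDist {𝓧 : Type*} [MeasurableSpace 𝓧] (P Q : Measure 𝓧) : ℝ :=
  √(∫ x, (√(P.rnDeriv (P + Q) x).toReal - √(Q.rnDeriv (P + Q) x).toReal) ^ 2 ∂(P + Q))

end WhiteNoise

end

noncomputable section

namespace WhiteNoise

/-! ### Elementary integrals of step functions -/

section Step

variable {Ω : Type*} [MeasurableSpace Ω] {P : Measure Ω} {B W : ℝ≥0 → Ω → ℝ}

/-! Integrating by parts, `∫ f(t) X_t dt = ∫ σ(s) u(s) dB_s` with `u = tail f`, so the observation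
is a centered Gaussian family with covariance form `q_σ(f, f) = ε²‖f‖² + ∫ σ² u²`
(`IsObservation.integral_cexp_sum`, `covForm_self`).

The Hellinger distance is controlled through its affinity, which AM-GM turns into a dual quantity: a
lower bound on `∫ h dP + ∫ h⁻¹ dQ` over bounded positive `h` (`AffinityDualBound`). Such a bound
passes to image measures, and it holds on `ℝ^{L²}` once it holds for all finite-dimensional
marginals, since cylinder functions are dense in `L¹`. Thus no densities on the infinite product are
needed.

On the span of finitely many test functions, `q_{σ₁}` and `q_{σ₂}` are diagonalized simultaneously,
giving images of products of `N(0,1)` and of `N(0,vᵢ)`. The affinity of these products is at least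
`1 - ∑ (vᵢ - 1)²`.

With `eᵢ` the diagonalizing basis, `δ = ‖σ₁² - σ₂²‖` and `m = min σ₁`, one has `|vᵢ - 1| ≤ δ ∫ uᵢ²`,
where `uᵢ = tail eᵢ`. Normalization gives `∫ uᵢ² ≤ m⁻²`. The interpolation inequality `tail_sq_le`
bounds the kernel `∑ uᵢ(s)²` by `(εm)⁻¹` at every `s`, so `∑ (vᵢ - 1)² ≤ δ² m⁻³ ε⁻¹`
(`sum_covForm_sub_one_sq_le`), whatever the dimension. Since `H² = 2 - 2 · affinity`, the first
claim follows with constant `√2`; the second trades `m^(3/2) ≤ M^(3/2)` for the larger exponent. -/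

lemma volume_real_Ioc_inter_Ioc (s t s' t' : unitInterval) (h : s ≤ t) (h' : s' ≤ t') :
    volume.real (Set.Ioc s t ∩ Set.Ioc s' t') =
      (min (t : ℝ) t' - min (t : ℝ) s') - (min (s : ℝ) t' - min (s : ℝ) s') := by
  rw [Set.Ioc_inter_Ioc, Measure.real, unitInterval.volume_Ioc]
  have e1 : (((t ⊓ t' : unitInterval)) : ℝ) = min (t : ℝ) t' := Subtype.mono_coe _ |>.map_min
  have e2 : (((s ⊔ s' : unitInterval)) : ℝ) = max (s : ℝ) s' := Subtype.mono_coe _ |>.map_max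
  have h : (s : ℝ) ≤ t := h
  have h' : (s' : ℝ) ≤ t' := h'
  rw [e1, e2, ENNReal.toReal_ofReal']
  grind

lemma StepFun.memLp_toFun (φ : StepFun) (p : ℝ≥0∞) :
    MemLp φ.toFun p (volume : Measure unitInterval) :=
  memLp_finsetSum _ fun _ _ => (memLp_const _).indicator measurableSet_Ioc

lemma StepFun.integral_toFun_sq (φ : StepFun) :
    ∫ x, φ.toFun x ^ 2 = ∑ i, ∑ j, φ.a i * φ.a j *
      volume.real (Set.Ioc (φ.s i) (φ.t i) ∩ Set.Ioc (φ.s j) (φ.t j)) := by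
  have h : ∀ x, φ.toFun x ^ 2 = ∑ i, ∑ j,
      (Set.Ioc (φ.s i) (φ.t i) ∩ Set.Ioc (φ.s j) (φ.t j)).indicator
        (fun _ => φ.a i * φ.a j) x := by
    intro x
    rw [StepFun.toFun, sq, Finset.sum_mul_sum]
    refine Finset.sum_congr rfl fun i _ => Finset.sum_congr rfl fun j _ => ?_
    rw [Set.inter_indicator_mul]
  have hm : ∀ i j, MeasurableSet (Set.Ioc (φ.s i) (φ.t i) ∩ Set.Ioc (φ.s j) (φ.t j)) :=
    fun i j => measurableSet_Ioc.inter measurableSet_Ioc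
  have hi : ∀ i j, Integrable ((Set.Ioc (φ.s i) (φ.t i) ∩ Set.Ioc (φ.s j) (φ.t j)).indicator
        (fun _ => φ.a i * φ.a j)) (volume : Measure unitInterval) :=
    fun i j => (integrable_const _).indicator (hm i j)
  simp_rw [h]
  rw [integral_finsetSum _ fun i _ => integrable_finsetSum _ fun j _ => hi i j]
  refine Finset.sum_congr rfl fun i _ => ?_
  rw [integral_finsetSum _ fun j _ => hi i j]
  refine Finset.sum_congr rfl fun j _ => ?_
  rw [integral_indicator_const _ (hm i j), smul_eq_mul, mul_comm]

lemma StepFun.hasGaussianLaw_integral (φ : StepFun) (hB : IsPreBrownianReal B P) :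
    HasGaussianLaw (φ.integral B) P := by
  classical
  let I : Finset ℝ≥0 := (Finset.univ.image fun i => unitInterval.toNNReal (φ.t i)) ∪
    (Finset.univ.image fun i => unitInterval.toNNReal (φ.s i))
  let L : (I → ℝ) →L[ℝ] ℝ := ∑ i, φ.a i •
    (ContinuousLinearMap.proj (R := ℝ) (φ := fun _ : I => ℝ)
        ⟨unitInterval.toNNReal (φ.t i), by simp [I]⟩ -
      ContinuousLinearMap.proj (R := ℝ) (φ := fun _ : I => ℝ)
        ⟨unitInterval.toNNReal (φ.s i), by simp [I]⟩)
  have := (hB.isGaussianProcess.hasGaussianLaw I).map_fun L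
  refine this.congr (.of_forall fun ω => ?_)
  simp [L, StepFun.integral]

lemma StepFun.integral_integral (φ : StepFun) (hB : IsPreBrownianReal B P) :
    ∫ ω, φ.integral B ω ∂P = 0 := by
  unfold StepFun.integral
  rw [integral_finsetSum]
  · refine Finset.sum_eq_zero fun i _ => ?_
    rw [integral_const_mul, integral_sub (hB.integrable_eval _) (hB.integrable_eval _),
      hB.integral_eval, hB.integral_eval, sub_zero, mul_zero]
  · exact fun i _ => ((hB.integrable_eval _).sub (hB.integrable_eval _)).const_mul _

/-- The covariance `min` of Brownian motion makes the covariance of two increments equal to the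
length of the overlap of their intervals. This is the Itô isometry for step functions, and it
tolerates overlapping intervals. -/
lemma StepFun.variance_integral (φ : StepFun) (hB : IsPreBrownianReal B P) :
    Var[φ.integral B; P] = ∫ x, φ.toFun x ^ 2 := by
  have : IsProbabilityMeasure P := hB.isGaussianProcess.isProbabilityMeasure
  have hm : ∀ t, MemLp (B t) 2 P := fun t => (hB.isGaussianProcess.hasGaussianLaw_eval t).memLp_two
  have hmf : ∀ t, MemLp (fun ω => B t ω) 2 P := hm
  rw [← covariance_self (φ.hasGaussianLaw_integral hB).aemeasurable, φ.integral_toFun_sq]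
  unfold StepFun.integral
  rw [covariance_fun_sum_fun_sum]
  · refine Finset.sum_congr rfl fun i _ => Finset.sum_congr rfl fun j _ => ?_
    rw [covariance_const_mul_left, covariance_const_mul_right,
      covariance_fun_sub_fun_sub (hmf _) (hmf _) (hmf _) (hmf _), hB.covariance_fun_eval,
      hB.covariance_fun_eval, hB.covariance_fun_eval, hB.covariance_fun_eval,
      volume_real_Ioc_inter_Ioc _ _ _ _ (φ.s_le_t i) (φ.s_le_t j)]
    push_cast
    simp only [unitInterval.coe_toNNReal]
    ring
  · exact fun i => ((hm _).sub (hm _)).const_mul _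
  · exact fun i => ((hm _).sub (hm _)).const_mul _

/-- The characteristic function of the elementary integral of a step function. -/
lemma StepFun.integral_cexp_integral (φ : StepFun) (hB : IsPreBrownianReal B P) (c : ℝ) :
    ∫ ω, Complex.exp (Complex.I * ((c * φ.integral B ω : ℝ) : ℂ)) ∂P =
      Complex.exp (-((c ^ 2 * ∫ x, φ.toFun x ^ 2 : ℝ) : ℂ) / 2) := by
  have hg := φ.hasGaussianLaw_integral hB
  have h := hg.charFun_map_eq c
  rw [charFun_apply_real, integral_map hg.aemeasurable (by fun_prop)] at h
  have e1 : ∫ ω, inner ℝ c (φ.integral B ω) ∂P = 0 := by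
    simp only [RCLike.inner_apply, conj_trivial, integral_mul_const, φ.integral_integral hB,
      zero_mul]
  have e2 : Var[fun ω => inner ℝ c (φ.integral B ω); P] = c ^ 2 * ∫ x, φ.toFun x ^ 2 := by
    simp only [RCLike.inner_apply, conj_trivial, mul_comm _ c]
    rw [variance_const_mul, φ.variance_integral hB]
  rw [e1, e2] at h
  convert h using 1
  · congr with ω
    push_cast
    ring_nf
  · congr 1
    push_cast
    ring

/-- The joint characteristic function of elementary integrals against independent Brownian
motions. -/
lemma StepFun.integral_cexp_integral_add (φ ψ : StepFun) (hB : IsPreBrownianReal B P)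
    (hW : IsPreBrownianReal W P) (hBW : IndepFun (fun ω t => B t ω) (fun ω t => W t ω) P)
    (c : ℝ) :
    ∫ ω, Complex.exp (Complex.I * ((φ.integral B ω + c * ψ.integral W ω : ℝ) : ℂ)) ∂P =
      Complex.exp (-(((∫ x, φ.toFun x ^ 2) + c ^ 2 * ∫ x, ψ.toFun x ^ 2 : ℝ) : ℂ) / 2) := by
  -- The elementary integral is a measurable functional of the whole path, so independence of the
  -- paths passes to the integrals.
  let F (χ : StepFun) (x : ℝ≥0 → ℝ) : ℝ :=
    ∑ i, χ.a i * (x (unitInterval.toNNReal (χ.t i)) - x (unitInterval.toNNReal (χ.s i)))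
  have hF (χ : StepFun) : Measurable (F χ) := by fun_prop
  have h : IndepFun (φ.integral B) (ψ.integral W) P := hBW.comp (hF φ) (hF ψ)
  have h1 := h.comp (φ := fun x : ℝ => Complex.exp (Complex.I * x))
    (ψ := fun x : ℝ => Complex.exp (Complex.I * (c * x : ℝ))) (by fun_prop) (by fun_prop)
  have hmB := (φ.hasGaussianLaw_integral hB).aemeasurable
  have hmW := (ψ.hasGaussianLaw_integral hW).aemeasurable
  have h2 := h1.integral_fun_mul_eq_mul_integral
    (Measurable.comp_aemeasurable (by fun_prop) hmB).aestronglyMeasurable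
    (Measurable.comp_aemeasurable (by fun_prop) hmW).aestronglyMeasurable
  have h3 := φ.integral_cexp_integral hB 1
  have h4 := ψ.integral_cexp_integral hW c
  simp only [one_mul, one_pow] at h3
  simp only [Function.comp_apply] at h2
  rw [h3, h4, ← Complex.exp_add] at h2
  convert h2 using 1
  · congr with ω
    rw [← Complex.exp_add]
    push_cast
    ring_nf
  · congr 1
    push_cast
    ring

end Step

/-! ### Wiener integrals -/

section Wiener

variable {Ω : Type*} [MeasurableSpace Ω] {P : Measure Ω} {B W : ℝ≥0 → Ω → ℝ}

lemma integral_sq_eq_norm_toLp_sq {α : Type*} [MeasurableSpace α] {μ : Measure α} {f : α → ℝ}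
    (hf : MemLp f 2 μ) : ∫ x, f x ^ 2 ∂μ = ‖hf.toLp f‖ ^ 2 := by
  rw [← real_inner_self_eq_norm_sq, L2.inner_def]
  refine integral_congr_ae ?_
  filter_upwards [hf.coeFn_toLp] with x hx
  rw [hx, RCLike.inner_apply, conj_trivial, sq]

lemma tendsto_integral_sq_of_tendsto_eLpNorm {α : Type*} [MeasurableSpace α] {μ : Measure α}
    {f : ℕ → α → ℝ} {g : α → ℝ} (hf : ∀ k, MemLp (f k) 2 μ) (hg : MemLp g 2 μ)
    (h : Tendsto (fun k => eLpNorm (fun x => f k x - g x) 2 μ) atTop (𝓝 0)) :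
    Tendsto (fun k => ∫ x, f k x ^ 2 ∂μ) atTop (𝓝 (∫ x, g x ^ 2 ∂μ)) := by
  simp_rw [integral_sq_eq_norm_toLp_sq (hf _), integral_sq_eq_norm_toLp_sq hg]
  have : Tendsto (fun k => (hf k).toLp (f k)) atTop (𝓝 (hg.toLp g)) :=
    (Lp.tendsto_Lp_iff_tendsto_eLpNorm'' f hf g hg).2 h
  exact (this.norm).pow 2

lemma tendsto_eLpNorm_add_const_mul_sub {α : Type*} [MeasurableSpace α] {μ : Measure α}
    {f g : ℕ → α → ℝ} {u v : α → ℝ} (hf : ∀ k, AEStronglyMeasurable (f k) μ)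
    (hg : ∀ k, AEStronglyMeasurable (g k) μ) (hu : AEStronglyMeasurable u μ)
    (hv : AEStronglyMeasurable v μ) (c : ℝ)
    (hfu : Tendsto (fun k => eLpNorm (fun x => f k x - u x) 2 μ) atTop (𝓝 0))
    (hgv : Tendsto (fun k => eLpNorm (fun x => g k x - v x) 2 μ) atTop (𝓝 0)) :
    Tendsto (fun k => eLpNorm (fun x => (f k x + c * g k x) - (u x + c * v x)) 2 μ)
      atTop (𝓝 0) := by
  have h0 : Tendsto (fun k => eLpNorm (fun x => f k x - u x) 2 μ +
      ‖c‖ₑ * eLpNorm (fun x => g k x - v x) 2 μ) atTop (𝓝 0) := by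
    simpa using hfu.add (ENNReal.Tendsto.const_mul hgv (.inr (by simp)))
  refine tendsto_of_tendsto_of_tendsto_of_le_of_le tendsto_const_nhds h0
    (fun _ => zero_le) fun k => ?_
  have e : (fun x => (f k x + c * g k x) - (u x + c * v x)) =
      (fun x => f k x - u x) + c • fun x => g k x - v x := by
    ext x
    simp only [Pi.add_apply, Pi.smul_apply, smul_eq_mul]
    ring
  rw [e]
  refine (eLpNorm_add_le ((hf k).sub hu) (((hg k).sub hv).const_smul c)
    (by norm_num)).trans_eq ?_
  rw [eLpNorm_const_smul]
  rfl

lemma norm_cexp_I_mul_sub_le (x y : ℝ) :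
    ‖Complex.exp (Complex.I * x) - Complex.exp (Complex.I * y)‖ ≤ ‖x - y‖ := by
  have : Complex.exp (Complex.I * x) - Complex.exp (Complex.I * y) =
      Complex.exp (Complex.I * y) * (Complex.exp (Complex.I * (x - y : ℝ)) - 1) := by
    rw [mul_sub, ← Complex.exp_add, mul_one]
    congr 2
    push_cast
    ring
  rw [this, norm_mul, Complex.norm_exp_I_mul_ofReal, one_mul]
  exact Real.norm_exp_I_mul_ofReal_sub_one_le

lemma integrable_cexp_I_mul [IsFiniteMeasure P] {V : Ω → ℝ} (hV : AEMeasurable V P) :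
    Integrable (fun ω => Complex.exp (Complex.I * (V ω : ℂ))) P := by
  refine Integrable.of_bound (Measurable.comp_aemeasurable (g := fun x : ℝ =>
    Complex.exp (Complex.I * x)) (by fun_prop) hV).aestronglyMeasurable 1 (.of_forall fun ω => ?_)
  rw [Complex.norm_exp_I_mul_ofReal]

/-- The map `x ↦ exp(ix)` is 1-Lipschitz, and `L²` convergence implies `L¹` convergence on a
probability space. -/
lemma tendsto_integral_cexp_of_tendsto_eLpNorm [IsProbabilityMeasure P] {V : ℕ → Ω → ℝ}
    {U : Ω → ℝ} (hV : ∀ k, AEMeasurable (V k) P) (hU : AEMeasurable U P)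
    (h : Tendsto (fun k => eLpNorm (fun ω => V k ω - U ω) 2 P) atTop (𝓝 0)) :
    Tendsto (fun k => ∫ ω, Complex.exp (Complex.I * (V k ω : ℂ)) ∂P) atTop
      (𝓝 (∫ ω, Complex.exp (Complex.I * (U ω : ℂ)) ∂P)) := by
  refine tendsto_integral_of_L1' _ (integrable_cexp_I_mul hU).aestronglyMeasurable
    (.of_forall fun k => integrable_cexp_I_mul (hV k)) ?_
  refine tendsto_of_tendsto_of_tendsto_of_le_of_le tendsto_const_nhds h
    (fun _ => zero_le) fun k => ?_
  calc eLpNorm ((fun ω => Complex.exp (Complex.I * (V k ω : ℂ))) -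
        fun ω => Complex.exp (Complex.I * (U ω : ℂ))) 1 P
      ≤ eLpNorm (fun ω => V k ω - U ω) 1 P :=
        eLpNorm_mono fun ω => norm_cexp_I_mul_sub_le _ _
    _ ≤ eLpNorm (fun ω => V k ω - U ω) 2 P :=
        eLpNorm_le_eLpNorm_of_exponent_le (by norm_num)
          ((hV k).sub hU).aestronglyMeasurable

/-- The joint characteristic function of Wiener integrals against independent Brownian motions. -/
lemma IsWienerIntegral.integral_cexp_add {g f : unitInterval → ℝ} {U Z : Ω → ℝ}
    (hU : IsWienerIntegral P B g U) (hZ : IsWienerIntegral P W f Z)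
    (hB : IsPreBrownianReal B P) (hW : IsPreBrownianReal W P)
    (hBW : IndepFun (fun ω t => B t ω) (fun ω t => W t ω) P) (c : ℝ) :
    ∫ ω, Complex.exp (Complex.I * ((U ω + c * Z ω : ℝ) : ℂ)) ∂P =
      Complex.exp (-(((∫ x, g x ^ 2) + c ^ 2 * ∫ x, f x ^ 2 : ℝ) : ℂ) / 2) := by
  have : IsProbabilityMeasure P := hB.isGaussianProcess.isProbabilityMeasure
  obtain ⟨hg, hU2, φ, hφ, hφU⟩ := hU
  obtain ⟨hf, hZ2, ψ, hψ, hψZ⟩ := hZ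
  have hmB k := ((φ k).hasGaussianLaw_integral hB).aemeasurable
  have hmW k := ((ψ k).hasGaussianLaw_integral hW).aemeasurable
  have hmU := hU2.aestronglyMeasurable.aemeasurable
  have hmZ := hZ2.aestronglyMeasurable.aemeasurable
  have h1 : Tendsto (fun k => ∫ ω, Complex.exp (Complex.I *
      (((φ k).integral B ω + c * (ψ k).integral W ω : ℝ) : ℂ)) ∂P) atTop
      (𝓝 (∫ ω, Complex.exp (Complex.I * ((U ω + c * Z ω : ℝ) : ℂ)) ∂P)) := by
    refine tendsto_integral_cexp_of_tendsto_eLpNorm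
      (fun k => (hmB k).add ((hmW k).const_mul c)) (hmU.add (hmZ.const_mul c)) ?_
    exact tendsto_eLpNorm_add_const_mul_sub (fun k => (hmB k).aestronglyMeasurable)
      (fun k => (hmW k).aestronglyMeasurable) hU2.aestronglyMeasurable hZ2.aestronglyMeasurable c
      hφU hψZ
  simp_rw [(φ _).integral_cexp_integral_add (ψ _) hB hW hBW c] at h1
  have h2 := tendsto_integral_sq_of_tendsto_eLpNorm (fun k => (φ k).memLp_toFun 2) hg hφ
  have h3 := tendsto_integral_sq_of_tendsto_eLpNorm (fun k => (ψ k).memLp_toFun 2) hf hψ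
  have hc : Continuous fun x : ℝ => Complex.exp (-(x : ℂ) / 2) := by fun_prop
  exact tendsto_nhds_unique h1 ((hc.tendsto _).comp (h2.add (h3.const_mul (c ^ 2))))

/-- The sum of two step functions. -/
def StepFun.add (φ ψ : StepFun) : StepFun where
  n := φ.n + ψ.n
  a := Fin.addCases φ.a ψ.a
  s := Fin.addCases φ.s ψ.s
  t := Fin.addCases φ.t ψ.t
  s_le_t i := by
    refine Fin.addCases (fun i => ?_) (fun i => ?_) i
    · simpa using φ.s_le_t i
    · simpa using ψ.s_le_t i

lemma StepFun.toFun_add (φ ψ : StepFun) (x : unitInterval) :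
    (φ.add ψ).toFun x = φ.toFun x + ψ.toFun x := by
  simp only [StepFun.toFun]
  refine (Fin.sum_univ_add _).trans ?_
  simp [StepFun.add]

lemma StepFun.integral_add {S : Type*} (φ ψ : StepFun) (B : ℝ≥0 → S → ℝ) (ω : S) :
    (φ.add ψ).integral B ω = φ.integral B ω + ψ.integral B ω := by
  simp only [StepFun.integral]
  refine (Fin.sum_univ_add _).trans ?_
  simp [StepFun.add]

/-- The multiple of a step function by a constant. -/
def StepFun.smul (c : ℝ) (φ : StepFun) : StepFun where
  n := φ.n
  a i := c * φ.a i
  s := φ.s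
  t := φ.t
  s_le_t := φ.s_le_t

lemma StepFun.toFun_smul (c : ℝ) (φ : StepFun) (x : unitInterval) :
    (φ.smul c).toFun x = c * φ.toFun x := by
  simp only [StepFun.toFun, StepFun.smul, Finset.mul_sum]
  refine Finset.sum_congr rfl fun i _ => ?_
  by_cases h : x ∈ Set.Ioc (φ.s i) (φ.t i) <;> simp [h]

lemma StepFun.integral_smul {S : Type*} (c : ℝ) (φ : StepFun) (B : ℝ≥0 → S → ℝ) (ω : S) :
    (φ.smul c).integral B ω = c * φ.integral B ω := by
  simp only [StepFun.integral, StepFun.smul, Finset.mul_sum, mul_assoc]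
  rfl

lemma IsWienerIntegral.congr {g g' : unitInterval → ℝ} {U : Ω → ℝ}
    (hU : IsWienerIntegral P B g U) (h : g =ᵐ[volume] g') : IsWienerIntegral P B g' U := by
  obtain ⟨hg, hU2, φ, hφ, hφU⟩ := hU
  refine ⟨hg.ae_eq h, hU2, φ, ?_, hφU⟩
  convert hφ using 2 with k
  refine eLpNorm_congr_ae ?_
  filter_upwards [h] with x hx
  rw [hx]

lemma IsWienerIntegral.zero (P : Measure Ω) (B : ℝ≥0 → Ω → ℝ) :
    IsWienerIntegral P B (fun _ => 0) (fun _ => 0) := by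
  refine ⟨MemLp.zero', MemLp.zero', fun _ => ⟨0, Fin.elim0, Fin.elim0, Fin.elim0, (Fin.elim0 ·)⟩,
    ?_, ?_⟩
  · simp [StepFun.toFun]
  · simp [StepFun.integral]

lemma IsWienerIntegral.add_smul {g f : unitInterval → ℝ} {U Z : Ω → ℝ}
    (hB : IsPreBrownianReal B P)
    (hU : IsWienerIntegral P B g U) (hZ : IsWienerIntegral P B f Z) (c : ℝ) :
    IsWienerIntegral P B (fun x => g x + c * f x) (fun ω => U ω + c * Z ω) := by
  obtain ⟨hg, hU2, φ, hφ, hφU⟩ := hU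
  obtain ⟨hf, hZ2, ψ, hψ, hψZ⟩ := hZ
  refine ⟨hg.add (hf.const_mul c), hU2.add (hZ2.const_mul c),
    fun k => (φ k).add ((ψ k).smul c), ?_, ?_⟩
  · simp only [StepFun.toFun_add, StepFun.toFun_smul]
    exact tendsto_eLpNorm_add_const_mul_sub (fun k => ((φ k).memLp_toFun 2).aestronglyMeasurable)
      (fun k => ((ψ k).memLp_toFun 2).aestronglyMeasurable) hg.aestronglyMeasurable
      hf.aestronglyMeasurable c hφ hψ
  · simp only [StepFun.integral_add, StepFun.integral_smul]
    exact tendsto_eLpNorm_add_const_mul_sub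
      (fun k => ((φ k).hasGaussianLaw_integral hB).aemeasurable.aestronglyMeasurable)
      (fun k => ((ψ k).hasGaussianLaw_integral hB).aemeasurable.aestronglyMeasurable)
      hU2.aestronglyMeasurable hZ2.aestronglyMeasurable c hφU hψZ

lemma IsWienerIntegral.sum {ι : Type*} (s : Finset ι) (c : ι → ℝ) {g : ι → unitInterval → ℝ}
    {U : ι → Ω → ℝ} (hB : IsPreBrownianReal B P) (hU : ∀ i, IsWienerIntegral P B (g i) (U i)) :
    IsWienerIntegral P B (fun x => ∑ i ∈ s, c i * g i x) (fun ω => ∑ i ∈ s, c i * U i ω) := by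
  classical
  induction s using Finset.induction_on with
  | empty => simpa using IsWienerIntegral.zero P B
  | insert i s hi ih =>
    simp only [Finset.sum_insert hi]
    convert ih.add_smul hB (hU i) (c i) using 2 <;> rw [add_comm]

end Wiener

/-! ### The tail integral -/

section Tail

/-- The tail integral `s ↦ ∫_s^1 f(t) dt`. -/
def tail (f : unitInterval → ℝ) (s : unitInterval) : ℝ := ∫ t in Set.Ici s, f t

lemma tail_eq_integral_indicator (f : unitInterval → ℝ) (s : unitInterval) :
    tail f s = ∫ t, (Set.Ici s).indicator f t :=
  (integral_indicator measurableSet_Ici).symm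

variable {f : unitInterval → ℝ}

lemma abs_tail_le (hf : Integrable f) (s : unitInterval) : |tail f s| ≤ ∫ t, |f t| :=
  (abs_integral_le_integral_abs).trans
    (setIntegral_le_integral hf.abs (.of_forall fun _ => abs_nonneg _))

/-- Dominated convergence: for `t ≠ s` the indicator of `[s', 1]` at `t` is constant for `s'` near
`s`, and `{s}` is a null set. -/
lemma continuous_tail (hf : Integrable f) : Continuous (tail f) := by
  refine continuous_iff_continuousAt.2 fun s => ?_
  simp_rw [funext (tail_eq_integral_indicator f)]
  refine continuousAt_of_dominated (bound := fun t => |f t|)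
    (.of_forall fun s' => (hf.indicator measurableSet_Ici).aestronglyMeasurable)
    (.of_forall fun s' => .of_forall fun t => norm_indicator_le_norm_self f t) hf.abs ?_
  filter_upwards [compl_mem_ae_iff.2 (measure_singleton s)] with t ht
  rcases lt_or_gt_of_ne (show t ≠ s from ht) with h | h
  · refine (continuousAt_const (y := 0)).congr ?_
    filter_upwards [lt_mem_nhds h] with s' hs'
    rw [Set.indicator_of_notMem (by simpa using hs')]
  · refine (continuousAt_const (y := f t)).congr ?_
    filter_upwards [gt_mem_nhds h] with s' hs'
    rw [Set.indicator_of_mem (by simpa using hs'.le)]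

/-- Integration by parts for the tail integral. -/
lemma integral_sq_eq_two_mul_integral_mul_tail (hf : Integrable f) :
    (∫ t, f t) ^ 2 = 2 * ∫ t, f t * tail f t := by
  -- The square is a double integral of `f(t) f(r)`; by symmetry the two triangles cut off by the
  -- diagonal contribute equally, each giving `∫ f · tail f`.
  have hp : Integrable (fun p : unitInterval × unitInterval => f p.1 * f p.2)
      (volume.prod volume) := hf.mul_prod hf
  have hS : MeasurableSet {p : unitInterval × unitInterval | p.1 ≤ p.2} :=
    measurableSet_le measurable_fst measurable_snd
  have hT : MeasurableSet {p : unitInterval × unitInterval | p.2 < p.1} :=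
    measurableSet_lt measurable_snd measurable_fst
  have hpS := hp.indicator hS
  have hpT := hp.indicator hT
  have h1 : ∫ p, {p : unitInterval × unitInterval | p.1 ≤ p.2}.indicator
      (fun p => f p.1 * f p.2) p ∂(volume.prod volume) = ∫ t, f t * tail f t := by
    rw [integral_prod _ hpS]
    congr with t
    rw [tail_eq_integral_indicator, ← integral_const_mul]
    congr with r
    by_cases h : t ≤ r <;> simp [h]
  have h2 : ∫ p, {p : unitInterval × unitInterval | p.2 < p.1}.indicator
      (fun p => f p.1 * f p.2) p ∂(volume.prod volume) = ∫ t, f t * tail f t := by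
    rw [integral_prod_symm _ hpT]
    congr with t
    rw [tail, integral_Ici_eq_integral_Ioi, ← integral_indicator measurableSet_Ioi,
      ← integral_const_mul]
    congr with r
    by_cases h : t < r <;> simp [h, mul_comm]
  have h3 : (∫ t, f t) ^ 2 = ∫ p, f p.1 * f p.2 ∂((volume : Measure unitInterval).prod
      (volume : Measure unitInterval)) := by
    rw [integral_prod_mul, sq]
  rw [h3, two_mul]
  nth_rw 1 [← h1]
  rw [← h2, ← integral_add hpS hpT]
  congr with p
  by_cases h : p.1 ≤ p.2
  · simp [h, h.not_gt]
  · simp [h, not_le.1 h]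

/-- The preceding identity applied to `f` cut off to `[s, 1]`, where the tail integral is unchanged.
-/
lemma tail_sq_eq (hf : Integrable f) (s : unitInterval) :
    tail f s ^ 2 = 2 * ∫ t in Set.Ici s, f t * tail f t := by
  rw [tail_eq_integral_indicator,
    integral_sq_eq_two_mul_integral_mul_tail (hf.indicator measurableSet_Ici),
    ← integral_indicator measurableSet_Ici]
  congr 2 with t
  by_cases h : s ≤ t
  · have : tail ((Set.Ici s).indicator f) t = tail f t := by
      rw [tail, tail]
      refine setIntegral_congr_fun measurableSet_Ici fun r hr => ?_
      exact Set.indicator_of_mem (show r ∈ Set.Ici s from h.trans hr) f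
    simp [h, this]
  · simp [h]

/-- The interpolation inequality `‖u‖_∞² ≤ 2 ‖u‖ ‖u'‖` for `u = tail f`, with weights. -/
lemma tail_sq_le (hf : MemLp f 2 volume) {a b : ℝ} (ha : 0 < a) (hb : 0 < b) (s : unitInterval) :
    tail f s ^ 2 ≤ (a ^ 2 * (∫ t, f t ^ 2) + b ^ 2 * ∫ t, tail f t ^ 2) / (a * b) := by
  have hfi : Integrable f := hf.integrable (by norm_num)
  have hT : MemLp (tail f) 2 volume :=
    MemLp.of_bound (continuous_tail hfi).aestronglyMeasurable _
      (.of_forall fun t => abs_tail_le hfi t)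
  have i1 : Integrable fun t => f t * tail f t := hf.integrable_mul hT
  have i2 := hf.integrable_sq
  have i3 := hT.integrable_sq
  rw [tail_sq_eq hfi, ← integral_const_mul, ← integral_const_mul, ← integral_const_mul,
    ← integral_add (i2.const_mul _) (i3.const_mul _), ← integral_div,
    ← integral_indicator measurableSet_Ici]
  refine integral_mono ((i1.const_mul 2).indicator measurableSet_Ici)
    (((i2.const_mul _).add (i3.const_mul _)).div_const _) fun t => ?_
  -- Off `[s, 1]` the left integrand vanishes and nonnegativity suffices; on it, expand `(a f - b
  -- tail f)² ≥ 0`.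
  have hk : 0 ≤ (a ^ 2 * f t ^ 2 + b ^ 2 * tail f t ^ 2) / (a * b) := by positivity
  have hk' : 2 * (f t * tail f t) ≤ (a ^ 2 * f t ^ 2 + b ^ 2 * tail f t ^ 2) / (a * b) := by
    rw [le_div_iff₀ (by positivity)]
    nlinarith [sq_nonneg (a * f t - b * tail f t)]
  by_cases h : s ≤ t <;> simp only [Set.indicator, Set.mem_Ici, h, if_true, if_false]
  · exact hk'
  · exact hk

end Tail

/-! ### The observation is a centered Gaussian process -/

section Observation

variable {Ω : Type*} [MeasurableSpace Ω] {P : Measure Ω} {B W : ℝ≥0 → Ω → ℝ}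
  {σ : C(unitInterval, ℝ)} {ε : ℝ} {X : unitInterval → Ω → ℝ} {Y : L2I → Ω → ℝ}

/-- Discretizing time turns the integral into a finite linear combination of values of `x`. Used
both for paths of the signal and for their kernels, it keeps the same coefficients on the two sides.
-/
lemma integral_mul_comp_simpleFunc {F : unitInterval → ℝ} (hF : Integrable F)
    (π : SimpleFunc unitInterval unitInterval) (x : unitInterval → ℝ) :
    ∫ t, F t * x (π t) = ∑ y ∈ π.range, (∫ t in π ⁻¹' {y}, F t) * x y := by
  have h (t : unitInterval) : F t * x (π t) =
      ∑ y ∈ π.range, (π ⁻¹' {y}).indicator (fun t => F t * x y) t := by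
    rw [Finset.sum_eq_single (π t)]
    · simp
    · intro y _ hy
      simp [hy.symm]
    · exact fun h => (h (SimpleFunc.mem_range_self _ _)).elim
  simp_rw [h]
  rw [integral_finsetSum _ fun y _ =>
    (hF.mul_const _).indicator (π.measurableSet_preimage {y})]
  refine Finset.sum_congr rfl fun y _ => ?_
  rw [integral_indicator (π.measurableSet_preimage {y}), integral_mul_const]

/-- Simple functions that converge pointwise to the identity of `[0,1]`. -/
def approxId (n : ℕ) : SimpleFunc unitInterval unitInterval :=
  SimpleFunc.approxOn id measurable_id Set.univ 0 (Set.mem_univ _) n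

lemma tendsto_approxId (t : unitInterval) :
    Tendsto (fun n => approxId n t) atTop (𝓝 t) :=
  SimpleFunc.tendsto_approxOn measurable_id (Set.mem_univ _) (by simp)

lemma tendsto_integral_mul_comp_approxId {F x : unitInterval → ℝ} (hF : Integrable F)
    (hx : Continuous x) :
    Tendsto (fun n => ∫ t, F t * x (approxId n t)) atTop (𝓝 (∫ t, F t * x t)) := by
  obtain ⟨C, hC⟩ := (isCompact_range hx).isBounded.exists_norm_le
  refine tendsto_integral_of_dominated_convergence (fun t => |F t| * C) (fun n => ?_)
    (hF.abs.mul_const C) (fun n => .of_forall fun t => ?_) (.of_forall fun t => ?_)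
  · exact hF.aestronglyMeasurable.mul
      (hx.measurable.comp (approxId n).measurable).aestronglyMeasurable
  · rw [norm_mul]
    exact mul_le_mul_of_nonneg_left (hC _ ⟨_, rfl⟩) (norm_nonneg _)
  · exact ((hx.tendsto t).comp (tendsto_approxId t)).const_mul _

/-- The kernel of the discretized signal converges to `σ · tail F`: at fixed `s`, the condition `s ≤
approxId n t` eventually agrees with `s ≤ t` unless `t = s`, a null set. -/
lemma tendsto_integral_mul_indicator_approxId {F : unitInterval → ℝ} (hF : Integrable F)
    (c : unitInterval → ℝ) (s : unitInterval) :
    Tendsto (fun n => ∫ t, F t * (Set.Iic (approxId n t)).indicator c s) atTop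
      (𝓝 (c s * tail F s)) := by
  rw [tail_eq_integral_indicator, ← integral_const_mul]
  have hm n : Measurable fun t => (Set.Iic (approxId n t)).indicator c s := by
    have : (fun t => (Set.Iic (approxId n t)).indicator c s) =
        (approxId n ⁻¹' Set.Ici s).indicator fun _ => c s := by
      ext t
      simp [Set.indicator]
    rw [this]
    exact measurable_const.indicator ((approxId n).measurableSet_preimage _)
  refine tendsto_integral_of_dominated_convergence (fun t => |F t| * |c s|) (fun n => ?_)
    (hF.abs.mul_const _) (fun n => .of_forall fun t => ?_) ?_
  · exact hF.aestronglyMeasurable.mul (hm n).aestronglyMeasurable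
  · rw [norm_mul]
    exact mul_le_mul_of_nonneg_left (norm_indicator_le_norm_self c s) (norm_nonneg _)
  · filter_upwards [compl_mem_ae_iff.2 (measure_singleton s)] with t ht
    rcases lt_or_gt_of_ne (show t ≠ s from ht) with h | h
    · refine tendsto_const_nhds.congr' ?_
      filter_upwards [(tendsto_approxId t).eventually (gt_mem_nhds h)] with n hn
      simp [h.not_ge, hn.not_ge]
    · refine tendsto_const_nhds.congr' ?_
      filter_upwards [(tendsto_approxId t).eventually (lt_mem_nhds h)] with n hn
      simp [h.le, hn.le, mul_comm]

/-- The characteristic function of `∫ F(t) X_t dt + c ∫ G dW`. -/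
lemma IsObservation.integral_cexp_signal_add (h : IsObservation P σ ε B W X Y)
    {F G : unitInterval → ℝ} (hF : Integrable F) {Z : Ω → ℝ} (hZ : IsWienerIntegral P W G Z)
    (c : ℝ) :
    ∫ ω, Complex.exp (Complex.I * (((∫ t, F t * X t ω) + c * Z ω : ℝ) : ℂ)) ∂P =
      Complex.exp (-(((∫ s, (σ s * tail F s) ^ 2) + c ^ 2 * ∫ x, G x ^ 2 : ℝ) : ℂ) / 2) := by
  have hB := h.brownian_B.toIsPreBrownianReal
  have : IsProbabilityMeasure P := hB.isGaussianProcess.isProbabilityMeasure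
  -- `U n` is `∫ F(t) X_{πₙ(t)} dt` with `πₙ = approxId n`. Being a finite combination of signal
  -- values, it is a Wiener integral, with kernel `k n`. Letting `n → ∞` replaces a stochastic
  -- Fubini theorem.
  set U : ℕ → Ω → ℝ := fun n ω =>
    ∑ y ∈ (approxId n).range, (∫ t in approxId n ⁻¹' {y}, F t) * X y ω with hU
  set k : ℕ → unitInterval → ℝ := fun n s =>
    ∑ y ∈ (approxId n).range, (∫ t in approxId n ⁻¹' {y}, F t) * (Set.Iic y).indicator σ s with hk
  have hUk n : IsWienerIntegral P B (k n) (U n) := .sum _ _ hB h.signal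
  have h1 n := (hUk n).integral_cexp_add hZ hB h.brownian_W.toIsPreBrownianReal h.indep c
  have hmZ := hZ.2.1.aestronglyMeasurable.aemeasurable
  have h2 : Tendsto (fun n => ∫ ω, Complex.exp (Complex.I * ((U n ω + c * Z ω : ℝ) : ℂ)) ∂P) atTop
      (𝓝 (∫ ω, Complex.exp (Complex.I * (((∫ t, F t * X t ω) + c * Z ω : ℝ) : ℂ)) ∂P)) := by
    -- Exponentials have modulus 1, so pathwise convergence, from continuity of the signal, is
    -- enough.
    refine tendsto_integral_of_dominated_convergence (fun _ => 1) (fun n => ?_)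
      (integrable_const _) (fun n => .of_forall fun ω => ?_) ?_
    · exact (integrable_cexp_I_mul ((hUk n).2.1.aestronglyMeasurable.aemeasurable.add
        (hmZ.const_mul c))).aestronglyMeasurable
    · rw [Complex.norm_exp_I_mul_ofReal]
    · filter_upwards [h.signal_continuous] with ω hω
      have h3 := (tendsto_integral_mul_comp_approxId hF hω).congr fun n =>
        integral_mul_comp_simpleFunc hF (approxId n) fun t => X t ω
      have hc : Continuous fun x : ℝ => Complex.exp (Complex.I * ((x + c * Z ω : ℝ) : ℂ)) := by
        fun_prop
      exact (hc.tendsto _).comp h3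
  have h4 s : Tendsto (fun n => k n s) atTop (𝓝 (σ s * tail F s)) := by
    exact (tendsto_integral_mul_indicator_approxId hF σ s).congr fun n =>
      integral_mul_comp_simpleFunc hF _ fun y => (Set.Iic y).indicator σ s
  -- The kernels are bounded by `‖F‖₁ ‖σ‖_∞` uniformly in `n`, so the variances converge as well.
  have h6 : Tendsto (fun n => ∫ s, k n s ^ 2) atTop (𝓝 (∫ s, (σ s * tail F s) ^ 2)) := by
    refine tendsto_integral_of_dominated_convergence (fun _ => ((∫ t, |F t|) * ‖σ‖) ^ 2)
      (fun n => ((hUk n).1.aestronglyMeasurable.pow 2))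
      (integrable_const _) (fun n => .of_forall fun s => ?_) (.of_forall fun s => (h4 s).pow 2)
    have h7 : |k n s| ≤ (∫ t, |F t|) * ‖σ‖ := by
      simp only [hk]
      rw [← integral_mul_comp_simpleFunc hF _ fun y => (Set.Iic y).indicator σ s,
        ← integral_mul_const]
      refine (abs_integral_le_integral_abs).trans (integral_mono_of_nonneg
        (.of_forall fun _ => abs_nonneg _) (hF.abs.mul_const _) (.of_forall fun t => ?_))
      simp only [abs_mul]
      exact mul_le_mul_of_nonneg_left ((norm_indicator_le_norm_self _ _).trans
        (σ.norm_coe_le_norm s)) (abs_nonneg _)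
    rw [norm_pow]
    exact pow_le_pow_left₀ (norm_nonneg _) h7 2
  have hc : Continuous fun x : ℝ => Complex.exp (-(x : ℂ) / 2) := by fun_prop
  simp_rw [h1] at h2
  exact tendsto_nhds_unique h2 ((hc.tendsto _).comp (h6.add_const _))

/-- The characteristic function of the finite-dimensional distributions of the observation. -/
lemma IsObservation.integral_cexp_sum (h : IsObservation P σ ε B W X Y) {ι : Type*} [Fintype ι]
    (a : ι → ℝ) (g : ι → L2I) :
    ∫ ω, Complex.exp (Complex.I * ((∑ i, a i * Y (g i) ω : ℝ) : ℂ)) ∂P =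
      Complex.exp (-(((∫ s, (σ s * tail (∑ i, a i • g i : L2I) s) ^ 2) +
        ε ^ 2 * ∫ x, (∑ i, a i • g i : L2I) x ^ 2 : ℝ) : ℂ) / 2) := by
  choose Z hZ hYZ using h.obs
  have hi (f : L2I) : Integrable f := (Lp.memLp f).integrable (by norm_num)
  have hg : (∑ i, a i • g i : L2I) =ᵐ[volume] fun x => ∑ i, a i * g i x := by
    have h1 : ∀ᵐ x, ∀ i, (a i • g i : L2I) x = a i * g i x :=
      ae_all_iff.2 fun i => Lp.coeFn_smul (a i) (g i)
    filter_upwards [h1, Lp.coeFn_finsetSum Finset.univ fun i => a i • g i] with x hx1 hx2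
    rw [hx2]
    simp [hx1]
  have hW : IsWienerIntegral P W (∑ i, a i • g i : L2I) fun ω => ∑ i, a i * Z (g i) ω :=
    (IsWienerIntegral.sum Finset.univ a h.brownian_W.toIsPreBrownianReal
      fun i => hZ (g i)).congr hg.symm
  rw [← h.integral_cexp_signal_add (hi _) hW ε]
  refine integral_congr_ae ?_
  have h2 : ∀ᵐ ω ∂P, ∀ i, Y (g i) ω = (∫ t, g i t * X t ω) + ε * Z (g i) ω :=
    ae_all_iff.2 fun i => hYZ (g i)
  filter_upwards [h2, h.signal_continuous] with ω hω hc
  obtain ⟨C, hC⟩ := (isCompact_range hc).isBounded.exists_norm_le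
  have h3 : ∫ t, (∑ i, a i • g i : L2I) t * X t ω = ∑ i, a i * ∫ t, g i t * X t ω := by
    simp_rw [← integral_const_mul]
    rw [← integral_finsetSum]
    · refine integral_congr_ae ?_
      filter_upwards [hg] with t ht
      rw [ht, Finset.sum_mul]
      simp only [mul_assoc]
    · exact fun i _ => ((hi (g i)).mul_bdd hc.aestronglyMeasurable
        (.of_forall fun t => hC _ ⟨t, rfl⟩)).const_mul _
  rw [h3]
  congr 3
  simp only [hω, mul_add, Finset.sum_add_distrib, Finset.mul_sum]
  congr 1
  exact Finset.sum_congr rfl fun i _ => by ring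

end Observation

/-! ### A dual bound for the Hellinger distance -/

section Hellinger

/-- Measurable cylinders form a ring generating the product σ-algebra, so they approximate every
measurable set in measure; linear combinations and density in `L¹` do the rest. The index set may be
uncountable. -/
lemma exists_cylinder_eLpNorm_sub_le {ι : Type*} (μ : Measure (ι → ℝ)) [IsFiniteMeasure μ]
    {f : (ι → ℝ) → ℝ} (hf : Integrable f μ) {δ : ℝ≥0∞} (hδ : δ ≠ 0) :
    ∃ (I : Finset ι) (g : (I → ℝ) → ℝ), Measurable g ∧
      eLpNorm (fun x => f x - g (I.restrict x)) 1 μ ≤ δ := by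
  classical
  suffices h : ∃ u : (ι → ℝ) → ℝ, eLpNorm (f - u) 1 μ ≤ δ ∧
      ∃ (I : Finset ι) (g : (I → ℝ) → ℝ), Measurable g ∧ u = fun x => g (I.restrict x) by
    obtain ⟨_, h, I, g, hg, rfl⟩ := h
    exact ⟨I, g, hg, h⟩
  refine MemLp.induction_dense (by norm_num) (fun u : (ι → ℝ) → ℝ => ∃ (I : Finset ι)
    (g : (I → ℝ) → ℝ), Measurable g ∧ u = fun x => g (I.restrict x)) ?_ ?_ ?_
    (memLp_one_iff_integrable.2 hf) hδ
  · intro c s hs _ η hη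
    obtain ⟨η', hη', hη'c⟩ : ∃ η' : ℝ≥0∞, 0 < η' ∧ ‖c‖ₑ * η' ≤ η := by
      obtain ⟨η', h1, h2⟩ := ENNReal.exists_pos_mul_lt (a := ‖c‖ₑ) (b := η) (by simp) hη
      exact ⟨η', h1, by rw [mul_comm]; exact h2.le⟩
    obtain ⟨t, ht, hts⟩ := exists_measure_symmDiff_lt_of_generateFrom_isSetRing (μ := μ)
      (isSetRing_measurableCylinders (α := fun _ : ι => ℝ))
      ⟨{Set.univ}, Set.countable_singleton _, by
        simpa using univ_mem_measurableCylinders (fun _ : ι => ℝ), by simp⟩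
      generateFrom_measurableCylinders.symm hs hη'
    obtain ⟨I, S, hS, rfl⟩ := (mem_measurableCylinders _).1 ht
    refine ⟨(cylinder I S).indicator fun _ => c, ?_, I, S.indicator fun _ => c,
      measurable_const.indicator hS, ?_⟩
    · have hm : MeasurableSet (symmDiff (cylinder I S) s) := (hS.cylinder I).symmDiff hs
      calc eLpNorm ((cylinder I S).indicator (fun _ => c) - s.indicator fun _ => c) 1 μ
          ≤ eLpNorm ((symmDiff (cylinder I S) s).indicator fun _ => c) 1 μ := by
            refine eLpNorm_mono fun x => ?_
            by_cases h1 : x ∈ cylinder I S <;> by_cases h2 : x ∈ s <;>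
              simp [h1, h2, Set.mem_symmDiff, -mem_cylinder]
        _ = ‖c‖ₑ * μ (symmDiff (cylinder I S) s) := by
            rw [eLpNorm_indicator_const hm (by norm_num) (by norm_num)]
            simp
        _ ≤ ‖c‖ₑ * η' := by gcongr
        _ ≤ η := hη'c
    · ext x
      simp [Set.indicator]
  · rintro _ _ ⟨I, g, hg, rfl⟩ ⟨J, k, hk, rfl⟩
    refine ⟨I ∪ J, fun x => g (Finset.restrict₂ (π := fun _ => ℝ)
      (Finset.subset_union_left : I ⊆ I ∪ J) x) + k (Finset.restrict₂ (π := fun _ => ℝ)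
      (Finset.subset_union_right : J ⊆ I ∪ J) x), ?_, rfl⟩
    exact (hg.comp (Finset.measurable_restrict₂ _)).add (hk.comp (Finset.measurable_restrict₂ _))
  · rintro _ ⟨I, g, hg, rfl⟩
    exact (hg.comp (Finset.measurable_restrict I)).aestronglyMeasurable

/-- The dual lower bound for the Hellinger affinity: it bounds `∫ h dP + ∫ h⁻¹ dQ` below, for all
positive `h` that are bounded above and bounded away from zero. -/
def AffinityDualBound {𝓧 : Type*} [MeasurableSpace 𝓧] (P Q : Measure 𝓧) (r : ℝ) : Prop :=
  ∀ (h : 𝓧 → ℝ) (a b : ℝ), Measurable h → 0 < a → (∀ x, h x ∈ Set.Icc a b) →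
    2 * r ≤ (∫ x, h x ∂P) + ∫ x, (h x)⁻¹ ∂Q

lemma integrable_of_mem_Icc {𝓧 : Type*} [MeasurableSpace 𝓧] {P : Measure 𝓧} [IsFiniteMeasure P]
    {h : 𝓧 → ℝ} {a b : ℝ} (hh : Measurable h) (hab : ∀ x, h x ∈ Set.Icc a b) : Integrable h P :=
  Integrable.of_mem_Icc a b hh.aemeasurable (.of_forall hab)

lemma inv_mem_Icc {x a b : ℝ} (ha : 0 < a) (hx : x ∈ Set.Icc a b) : x⁻¹ ∈ Set.Icc b⁻¹ a⁻¹ :=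
  ⟨inv_anti₀ (ha.trans_le hx.1) hx.2, inv_anti₀ ha hx.1⟩

/-- It suffices to verify the dual bound for the finite-dimensional distributions. -/
lemma AffinityDualBound.of_restrict {ι : Type*} {P Q : Measure (ι → ℝ)} [IsProbabilityMeasure P]
    [IsProbabilityMeasure Q] {r : ℝ}
    (H : ∀ I : Finset ι, AffinityDualBound (P.map I.restrict) (Q.map I.restrict) r) :
    AffinityDualBound P Q r := by
  intro h a b hh ha hab
  refine le_of_forall_pos_le_add fun η hη => ?_
  obtain ⟨x₀⟩ : Nonempty (ι → ℝ) := inferInstance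
  have hab' : a ≤ b := (hab x₀).1.trans (hab x₀).2
  -- Replacing `h` by a cylinder function costs `δ` in `∫ h dP` and `δ / a²` in `∫ h⁻¹ dQ`; these
  -- should add up to `η`. Approximating in `L¹(P + Q)` controls both measures at once.
  obtain ⟨δ, hδ, hδη⟩ : ∃ δ : ℝ, 0 < δ ∧ δ * (1 + (a ^ 2)⁻¹) = η :=
    ⟨η / (1 + (a ^ 2)⁻¹), by positivity, by field_simp⟩
  obtain ⟨I, g, hg, hfg⟩ := exists_cylinder_eLpNorm_sub_le (P + Q)
    (integrable_of_mem_Icc hh hab) (δ := ENNReal.ofReal δ) (by simpa using hδ)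
  -- Clamping to `[a, b]` makes the approximant admissible, and brings it no further from `h`, whose
  -- values lie in that interval.
  set k : (I → ℝ) → ℝ := fun y => max a (min b (g y)) with hk
  have hkm : Measurable k := measurable_const.max (measurable_const.min hg)
  have hkab y : k y ∈ Set.Icc a b := ⟨le_max_left _ _, max_le hab' (min_le_left _ _)⟩
  have hkm' : Measurable fun x : ι → ℝ => k (I.restrict x) := hkm.comp (Finset.measurable_restrict I)
  have hH := H I k a b hkm ha hkab
  rw [integral_map (Finset.measurable_restrict I).aemeasurable hkm.aestronglyMeasurable,
    integral_map (Finset.measurable_restrict I).aemeasurable hkm.inv.aestronglyMeasurable] at hH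
  have hd x : |h x - k (I.restrict x)| ≤ |h x - g (I.restrict x)| := by
    have := hab x
    simp only [hk, Set.mem_Icc] at this ⊢
    grind
  have hle (ν : Measure (ι → ℝ)) [IsFiniteMeasure ν] (hν : ν ≤ P + Q) :
      ∫ x, |h x - k (I.restrict x)| ∂ν ≤ δ := by
    have h1 : eLpNorm (fun x => h x - k (I.restrict x)) 1 ν ≤ ENNReal.ofReal δ :=
      ((eLpNorm_mono fun x => hd x).trans (eLpNorm_mono_measure _ hν)).trans hfg
    have hi : Integrable (fun x => h x - k (I.restrict x)) ν :=
      (integrable_of_mem_Icc hh hab).sub (integrable_of_mem_Icc hkm' fun x => hkab _)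
    rw [eLpNorm_one_eq_lintegral_enorm, ← ofReal_integral_norm_eq_lintegral_enorm hi] at h1
    exact (ENNReal.ofReal_le_ofReal_iff hδ.le).1 h1
  have hi1 : Integrable h P := integrable_of_mem_Icc hh hab
  have hi2 : Integrable (fun x => k (I.restrict x)) P := integrable_of_mem_Icc hkm' fun x => hkab _
  have hi3 : Integrable (fun x => (h x)⁻¹) Q :=
    integrable_of_mem_Icc hh.inv fun x => inv_mem_Icc ha (hab x)
  have hi4 : Integrable (fun x => (k (I.restrict x))⁻¹) Q :=
    integrable_of_mem_Icc hkm'.inv fun x => inv_mem_Icc ha (hkab _)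
  have hi5 : Integrable (fun x => |h x - k (I.restrict x)|) Q :=
    ((integrable_of_mem_Icc hh hab).sub (integrable_of_mem_Icc hkm' fun x => hkab _)).abs
  have hi6 : Integrable (fun x => |h x - k (I.restrict x)|) P := (hi1.sub hi2).abs
  have e1 : ∫ x, k (I.restrict x) ∂P ≤ (∫ x, h x ∂P) + δ := by
    refine le_trans ?_ (add_le_add_right (hle P (Measure.le_add_right le_rfl)) _)
    rw [← integral_add hi1 hi6]
    refine integral_mono hi2 (hi1.add hi6) fun x => ?_
    have := neg_abs_le (h x - k (I.restrict x))
    simp only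
    linarith
  have e2 : ∫ x, (k (I.restrict x))⁻¹ ∂Q ≤ (∫ x, (h x)⁻¹ ∂Q) + (a ^ 2)⁻¹ * δ := by
    refine le_trans ?_ (add_le_add_right (mul_le_mul_of_nonneg_left
      (hle Q (Measure.le_add_left le_rfl)) (by positivity)) _)
    rw [← integral_const_mul, ← integral_add hi3 (hi5.const_mul _)]
    refine integral_mono hi4 (hi3.add (hi5.const_mul _)) fun x => ?_
    have h1 : 0 < h x := ha.trans_le (hab x).1
    have h2 : 0 < k (I.restrict x) := ha.trans_le (hkab _).1
    have h3 : (k (I.restrict x))⁻¹ - (h x)⁻¹ =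
        (h x - k (I.restrict x)) * (h x * k (I.restrict x))⁻¹ := by
      field_simp
    have h4 : (h x * k (I.restrict x))⁻¹ ≤ (a ^ 2)⁻¹ := by
      refine inv_anti₀ (by positivity) ?_
      rw [sq]
      exact mul_le_mul (hab x).1 (hkab _).1 ha.le h1.le
    have h5 : (h x - k (I.restrict x)) * (h x * k (I.restrict x))⁻¹ ≤
        (a ^ 2)⁻¹ * |h x - k (I.restrict x)| := by
      rw [mul_comm]
      refine (mul_le_mul_of_nonneg_left (le_abs_self _) (by positivity)).trans
        (mul_le_mul_of_nonneg_right h4 (abs_nonneg _))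
    simp only
    linarith
  rw [mul_add, mul_one, mul_comm δ] at hδη
  linarith

/-- The ratio is the optimal test function `√(q/p)`, regularized by `η`. The estimate serves both
integrals of the dual bound, with `p` and `q` exchanged for the second. -/
lemma mul_sqrt_div_sqrt_le {p q η : ℝ} (hp : 0 ≤ p) (hp1 : p ≤ 1) (hq : 0 ≤ q) (hη : 0 < η) :
    p * (√(q + η) / √(p + η)) ≤ √p * √q + √η := by
  have h0 : 0 < √(p + η) := Real.sqrt_pos.2 (by linarith)
  have h1 : p ≤ √p * √(p + η) := by
    nth_rw 1 [← Real.mul_self_sqrt hp]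
    gcongr
    linarith
  have h2 : √(q + η) ≤ √q + √η := by
    rw [Real.sqrt_le_left (by positivity)]
    nlinarith [Real.sq_sqrt hq, Real.sq_sqrt hη.le, Real.sqrt_nonneg q, Real.sqrt_nonneg η,
      mul_nonneg (Real.sqrt_nonneg q) (Real.sqrt_nonneg η)]
  have h3 : √p ≤ 1 := Real.sqrt_le_one.2 hp1
  have h4 : p / √(p + η) ≤ √p := (div_le_iff₀ h0).2 h1
  calc p * (√(q + η) / √(p + η)) = p / √(p + η) * √(q + η) := by ring
    _ ≤ √p * (√q + √η) := by gcongr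
    _ ≤ √p * √q + √η := by nlinarith [Real.sqrt_nonneg η]

/-- Since `H² = 2 - 2 ∫ √p √q`, it suffices to bound the affinity below by `r`. Equality in AM-GM
occurs at `h = √(q/p)`, which need not be bounded or bounded away from zero; test with its
`η`-regularization and let `η → 0`. -/
lemma AffinityDualBound.hellingerDist_le {𝓧 : Type*} [MeasurableSpace 𝓧] {P Q : Measure 𝓧}
    [IsProbabilityMeasure P] [IsProbabilityMeasure Q] {r : ℝ} (H : AffinityDualBound P Q r) :
    hellingerDist P Q ≤ √(2 - 2 * r) := by
  set μ := P + Q with hμ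
  have hPμ : P ≪ μ := Measure.AbsolutelyContinuous.rfl.add_right Q
  have hQμ : Q ≪ μ := by rw [hμ, add_comm]; exact Measure.AbsolutelyContinuous.rfl.add_right P
  set p : 𝓧 → ℝ := fun x => (P.rnDeriv μ x).toReal with hp
  set q : 𝓧 → ℝ := fun x => (Q.rnDeriv μ x).toReal with hq
  have hpm : Measurable p := (Measure.measurable_rnDeriv _ _).ennreal_toReal
  have hqm : Measurable q := (Measure.measurable_rnDeriv _ _).ennreal_toReal
  have hp0 x : 0 ≤ p x := ENNReal.toReal_nonneg
  have hq0 x : 0 ≤ q x := ENNReal.toReal_nonneg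
  have hpi : Integrable p μ := Measure.integrable_toReal_rnDeriv
  have hqi : Integrable q μ := Measure.integrable_toReal_rnDeriv
  have hpI : ∫ x, p x ∂μ = 1 := by rw [Measure.integral_toReal_rnDeriv hPμ]; simp
  have hqI : ∫ x, q x ∂μ = 1 := by rw [Measure.integral_toReal_rnDeriv hQμ]; simp
  have hpq : ∀ᵐ x ∂μ, p x + q x = 1 := by
    filter_upwards [Measure.rnDeriv_add' P Q μ, Measure.rnDeriv_self μ, P.rnDeriv_ne_top μ,
      Q.rnDeriv_ne_top μ] with x h1 h2 h3 h4
    rw [← hμ, h2] at h1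
    simp only [hp, hq]
    rw [← ENNReal.toReal_add h3 h4]
    simp only [Pi.add_apply] at h1
    rw [← h1, ENNReal.toReal_one]
  have hsi : Integrable (fun x => √(p x) * √(q x)) μ := by
    refine (hpi.add hqi).mono' (by fun_prop) (.of_forall fun x => ?_)
    rw [Real.norm_of_nonneg (by positivity), Pi.add_apply]
    nlinarith [sq_nonneg (√(p x) - √(q x)), Real.sq_sqrt (hp0 x), Real.sq_sqrt (hq0 x), hp0 x,
      hq0 x]
  have key : 2 * r ≤ 2 * ∫ x, √(p x) * √(q x) ∂μ := by
    have h1 : ∀ η : ℝ, 0 < η → 2 * r ≤ 2 * (∫ x, √(p x) * √(q x) ∂μ) + 4 * √η := by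
      intro η hη
      -- Truncation at 1 makes the bounds on `h` hold everywhere. As `p + q = 1` almost everywhere,
      -- it changes nothing up to a null set.
      set p' : 𝓧 → ℝ := fun x => min (p x) 1 with hp'
      set q' : 𝓧 → ℝ := fun x => min (q x) 1 with hq'
      have hp'm : Measurable p' := hpm.min measurable_const
      have hq'm : Measurable q' := hqm.min measurable_const
      have hp'0 x : 0 ≤ p' x := le_min (hp0 x) zero_le_one
      have hq'0 x : 0 ≤ q' x := le_min (hq0 x) zero_le_one
      have hp'1 x : p' x ≤ 1 := min_le_right _ _
      have hq'1 x : q' x ≤ 1 := min_le_right _ _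
      have hm : Measurable fun x => √(q' x + η) / √(p' x + η) := by fun_prop
      have hb x : √(q' x + η) / √(p' x + η) ∈ Set.Icc (√η / √(1 + η)) (√(1 + η) / √η) := by
        have i1 : √η ≤ √(q' x + η) := Real.sqrt_le_sqrt (by linarith [hq'0 x])
        have i2 : √η ≤ √(p' x + η) := Real.sqrt_le_sqrt (by linarith [hp'0 x])
        have i3 : √(q' x + η) ≤ √(1 + η) := Real.sqrt_le_sqrt (by linarith [hq'1 x])
        have i4 : √(p' x + η) ≤ √(1 + η) := Real.sqrt_le_sqrt (by linarith [hp'1 x])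
        have i5 : 0 < √η := Real.sqrt_pos.2 hη
        constructor
        · gcongr
        · gcongr
      have hH := H _ _ _ hm (by positivity) hb
      rw [← integral_rnDeriv_smul hPμ, ← integral_rnDeriv_smul hQμ] at hH
      have j1 : ∫ x, (P.rnDeriv μ x).toReal • (√(q' x + η) / √(p' x + η)) ∂μ ≤
          ∫ x, (√(p x) * √(q x) + √η) ∂μ := by
        refine integral_mono_of_nonneg (.of_forall fun x => ?_) (hsi.add (integrable_const _)) ?_
        · exact mul_nonneg (hp0 x) (by positivity)
        · filter_upwards [hpq] with x hx
          have l1 : p' x = p x := min_eq_left (by linarith [hq0 x])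
          have l2 : q' x = q x := min_eq_left (by linarith [hp0 x])
          rw [l1, l2]
          exact mul_sqrt_div_sqrt_le (hp0 x) (by linarith [hq0 x]) (hq0 x) hη
      have j2 : ∫ x, (Q.rnDeriv μ x).toReal • (√(q' x + η) / √(p' x + η))⁻¹ ∂μ ≤
          ∫ x, (√(p x) * √(q x) + √η) ∂μ := by
        refine integral_mono_of_nonneg (.of_forall fun x => ?_) (hsi.add (integrable_const _)) ?_
        · exact mul_nonneg (hq0 x) (by positivity)
        · filter_upwards [hpq] with x hx
          have l1 : p' x = p x := min_eq_left (by linarith [hq0 x])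
          have l2 : q' x = q x := min_eq_left (by linarith [hp0 x])
          rw [l1, l2, inv_div, mul_comm (√(p x))]
          exact mul_sqrt_div_sqrt_le (hq0 x) (by linarith [hp0 x]) (hp0 x) hη
      have j3 : ∫ x, (√(p x) * √(q x) + √η) ∂μ = (∫ x, √(p x) * √(q x) ∂μ) + 2 * √η := by
        have : μ.real Set.univ = 2 := by
          rw [hμ, measureReal_add_apply]
          simp
          norm_num
        rw [integral_add hsi (integrable_const _), integral_const, this, smul_eq_mul]
      linarith
    have h2 : Tendsto (fun η : ℝ => 2 * (∫ x, √(p x) * √(q x) ∂μ) + 4 * √η) (𝓝[>] 0)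
        (𝓝 (2 * (∫ x, √(p x) * √(q x) ∂μ) + 4 * √0)) := by
      have : Continuous fun η : ℝ => 2 * (∫ x, √(p x) * √(q x) ∂μ) + 4 * √η := by fun_prop
      exact (this.tendsto 0).mono_left nhdsWithin_le_nhds
    rw [Real.sqrt_zero, mul_zero, add_zero] at h2
    exact ge_of_tendsto h2 (by filter_upwards [self_mem_nhdsWithin] with η hη using h1 η hη)
  refine Real.sqrt_le_sqrt ?_
  have e : ∀ x, (√(p x) - √(q x)) ^ 2 = p x + q x - 2 * (√(p x) * √(q x)) := by
    intro x
    rw [sub_sq, Real.sq_sqrt (hp0 x), Real.sq_sqrt (hq0 x)]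
    ring
  change ∫ x, (√(p x) - √(q x)) ^ 2 ∂μ ≤ _
  simp_rw [e]
  rw [integral_sub (f := fun x => p x + q x) (hpi.add hqi) (hsi.const_mul 2), integral_add hpi hqi, hpI, hqI,
    integral_const_mul]
  linarith

end Hellinger

/-! ### The affinity of centered Gaussian product measures -/

section GaussianAffinity

variable {ι : Type*} [Fintype ι]

lemma pi_withDensity_ofReal {f : ι → ℝ → ℝ} (hf : ∀ i, Integrable (f i))
    (h0 : ∀ i x, 0 ≤ f i x) :
    Measure.pi (fun i => (volume : Measure ℝ).withDensity fun x => ENNReal.ofReal (f i x)) =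
      (volume : Measure (ι → ℝ)).withDensity fun x => ENNReal.ofReal (∏ i, f i (x i)) := by
  have hfin i : IsFiniteMeasure ((volume : Measure ℝ).withDensity
      fun x => ENNReal.ofReal (f i x)) := isFiniteMeasure_withDensity_ofReal (hf i).2
  refine Measure.pi_eq fun s hs => ?_
  rw [withDensity_apply _ (MeasurableSet.univ_pi hs), volume_pi, Measure.restrict_pi_pi,
    ← ofReal_integral_eq_lintegral_ofReal, integral_fintype_prod_eq_prod (f := f),
    ENNReal.ofReal_prod_of_nonneg fun i _ => integral_nonneg (h0 i)]
  · refine Finset.prod_congr rfl fun i _ => ?_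
    rw [withDensity_apply _ (hs i), ofReal_integral_eq_lintegral_ofReal (hf i).restrict
      (.of_forall (h0 i))]
  · exact Integrable.fintype_prod fun i => (hf i).restrict
  · exact .of_forall fun x => Finset.prod_nonneg fun i _ => h0 i _

/-- Pointwise `F h + G h⁻¹ ≥ 2 √(F G)` for the product densities `F` and `G`, and the integral of
`√(F G)` factorizes. -/
lemma AffinityDualBound.pi_withDensity {f g : ι → ℝ → ℝ} (hf : ∀ i, Integrable (f i))
    (hfm : ∀ i, Measurable (f i)) (hf0 : ∀ i x, 0 ≤ f i x) (hg : ∀ i, Integrable (g i))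
    (hgm : ∀ i, Measurable (g i)) (hg0 : ∀ i x, 0 ≤ g i x) :
    AffinityDualBound
      (Measure.pi fun i => (volume : Measure ℝ).withDensity fun x => ENNReal.ofReal (f i x))
      (Measure.pi fun i => (volume : Measure ℝ).withDensity fun x => ENNReal.ofReal (g i x))
      (∏ i, ∫ x, √(f i x * g i x)) := by
  intro h a b hh ha hab
  have hF0 (x : ι → ℝ) : 0 ≤ ∏ i, f i (x i) := Finset.prod_nonneg fun i _ => hf0 i _
  have hG0 (x : ι → ℝ) : 0 ≤ ∏ i, g i (x i) := Finset.prod_nonneg fun i _ => hg0 i _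
  have hFi : Integrable fun x : ι → ℝ => ∏ i, f i (x i) := Integrable.fintype_prod hf
  have hGi : Integrable fun x : ι → ℝ => ∏ i, g i (x i) := Integrable.fintype_prod hg
  rw [pi_withDensity_ofReal hf hf0, pi_withDensity_ofReal hg hg0,
    integral_withDensity_eq_integral_toReal_smul (by fun_prop) (by simp),
    integral_withDensity_eq_integral_toReal_smul (by fun_prop) (by simp)]
  simp only [ENNReal.toReal_ofReal (hF0 _), ENNReal.toReal_ofReal (hG0 _), smul_eq_mul]
  have i1 : Integrable fun x : ι → ℝ => (∏ i, f i (x i)) * h x :=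
    hFi.mul_bdd (c := b) hh.aestronglyMeasurable (.of_forall fun x => by
      rw [Real.norm_of_nonneg (ha.le.trans (hab x).1)]; exact (hab x).2)
  have i2 : Integrable fun x : ι → ℝ => (∏ i, g i (x i)) * (h x)⁻¹ :=
    hGi.mul_bdd (c := a⁻¹) hh.inv.aestronglyMeasurable (.of_forall fun x => by
      rw [Real.norm_of_nonneg (inv_nonneg.2 (ha.le.trans (hab x).1))]
      exact inv_anti₀ ha (hab x).1)
  rw [← integral_add i1 i2, ← integral_fintype_prod_volume_eq_prod, ← integral_const_mul]
  refine integral_mono_of_nonneg (.of_forall fun x => ?_) (i1.add i2) (.of_forall fun x => ?_)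
  · exact mul_nonneg zero_le_two (Finset.prod_nonneg fun i _ => Real.sqrt_nonneg _)
  · have hx : 0 < h x := ha.trans_le (hab x).1
    have e : ∏ i, √(f i (x i) * g i (x i)) = √((∏ i, f i (x i)) * ∏ i, g i (x i)) := by
      rw [← Finset.prod_mul_distrib, Real.sqrt_prod _ fun i _ => mul_nonneg (hf0 i _) (hg0 i _)]
    simp only
    rw [e, ← Real.sqrt_sq (show 0 ≤ (∏ i, f i (x i)) * h x + (∏ i, g i (x i)) * (h x)⁻¹ by
      have := hF0 x; have := hG0 x; positivity),
      show (2 : ℝ) = √4 by rw [show (4 : ℝ) = 2 ^ 2 by norm_num]; simp,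
      ← Real.sqrt_mul (by norm_num)]
    refine Real.sqrt_le_sqrt ?_
    have hinv : (h x) * (h x)⁻¹ = 1 := mul_inv_cancel₀ hx.ne'
    have : (∏ i, f i (x i)) * (∏ i, g i (x i)) =
      ((∏ i, f i (x i)) * h x) * ((∏ i, g i (x i)) * (h x)⁻¹) := by
      linear_combination (-(∏ i, f i (x i)) * ∏ i, g i (x i)) * hinv
    rw [this]
    nlinarith [sq_nonneg ((∏ i, f i (x i)) * h x - (∏ i, g i (x i)) * (h x)⁻¹)]

/-- The Hellinger affinity of `N(0,1)` and `N(0,v)`. -/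
lemma integral_sqrt_gaussianPDFReal {v : ℝ≥0} (hv : v ≠ 0) :
    ∫ x, √(gaussianPDFReal 0 1 x * gaussianPDFReal 0 v x) = √(2 * √v / (1 + v)) := by
  have hv' : (0 : ℝ) < v := by positivity
  have e x : √(gaussianPDFReal 0 1 x * gaussianPDFReal 0 v x) =
      √((2 * Real.pi * √v)⁻¹) * Real.exp (-((1 + v) / (4 * v)) * x ^ 2) := by
    rw [← Real.sqrt_sq (Real.exp_pos (-((1 + v) / (4 * v)) * x ^ 2)).le,
      ← Real.sqrt_mul (by positivity)]
    congr 1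
    simp only [gaussianPDFReal, NNReal.coe_one, mul_one, sub_zero]
    rw [← Real.exp_nat_mul, show (√(2 * Real.pi))⁻¹ * Real.exp (-x ^ 2 / 2) *
      ((√(2 * Real.pi * v))⁻¹ * Real.exp (-x ^ 2 / (2 * v))) = ((√(2 * Real.pi))⁻¹ *
      (√(2 * Real.pi * v))⁻¹) * (Real.exp (-x ^ 2 / 2) * Real.exp (-x ^ 2 / (2 * v))) by ring,
      ← Real.exp_add]
    congr 1
    · rw [Real.sqrt_mul (by positivity) (v : ℝ), ← mul_inv, ← mul_assoc,
        Real.mul_self_sqrt (by positivity)]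
    · congr 1
      push_cast
      field_simp
      ring
  simp_rw [e]
  rw [integral_const_mul, integral_gaussian, ← Real.sqrt_mul (by positivity)]
  congr 1
  have h2 : √(v : ℝ) * √v = v := Real.mul_self_sqrt hv'.le
  have : 0 < √(v : ℝ) := Real.sqrt_pos.2 hv'
  have := Real.pi_pos
  field_simp
  linear_combination (-4 : ℝ) * h2

/-- With `w = √v`, the number `2w / (1 + w²) = 1 - (w - 1)² / (1 + w²)` lies in `[0, 1]`, hence
below its square root. The defect is at most `(w - 1)² (w + 1)² = (v - 1)²`, because `(w + 1)² (1 +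
w²) ≥ 1`. -/
lemma one_sub_sq_le_affinity {v : ℝ≥0} :
    1 - ((v : ℝ) - 1) ^ 2 ≤ √(2 * √v / (1 + v)) ∧ √(2 * √v / (1 + v)) ≤ 1 := by
  set w := √(v : ℝ) with hw
  have hw0 : 0 ≤ w := Real.sqrt_nonneg _
  have h2 : (v : ℝ) = w ^ 2 := (Real.sq_sqrt v.2).symm
  rw [h2]
  have h1 : 2 * w / (1 + w ^ 2) ≤ 1 := by
    rw [div_le_one (by positivity)]
    nlinarith [sq_nonneg (w - 1)]
  have h0 : 0 ≤ 2 * w / (1 + w ^ 2) := by positivity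
  refine ⟨?_, Real.sqrt_le_one.2 h1⟩
  have h3 : 2 * w / (1 + w ^ 2) ≤ √(2 * w / (1 + w ^ 2)) := by
    refine Real.le_sqrt_of_sq_le ?_
    nlinarith
  refine le_trans ?_ h3
  rw [le_div_iff₀ (by positivity)]
  have h4 : 0 ≤ (w - 1) ^ 2 * ((w + 1) ^ 2 * (1 + w ^ 2) - 1) :=
    mul_nonneg (sq_nonneg _) (by nlinarith [pow_nonneg hw0 3, pow_nonneg hw0 4, sq_nonneg w])
  nlinarith

/-- A Weierstrass product inequality. Factors in `[0, 1]` suffice, with no upper bound on `y`, so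
the perturbations `(vᵢ - 1)²` need not be small. -/
lemma one_sub_sum_le_prod {κ : Type*} (s : Finset κ) (x y : κ → ℝ) (hxy : ∀ i, 1 - y i ≤ x i)
    (h0 : ∀ i, 0 ≤ x i) (h1 : ∀ i, x i ≤ 1) : 1 - ∑ i ∈ s, y i ≤ ∏ i ∈ s, x i := by
  classical
  induction s using Finset.induction_on with
  | empty => simp
  | insert i s hi ih =>
    rw [Finset.sum_insert hi, Finset.prod_insert hi]
    have h2 : ∏ j ∈ s, x j ≤ 1 := Finset.prod_le_one (fun j _ => h0 j) fun j _ => h1 j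
    have h3 : 0 ≤ ∏ j ∈ s, x j := Finset.prod_nonneg fun j _ => h0 j
    nlinarith [hxy i, h0 i, h1 i]

lemma AffinityDualBound.mono {𝓧 : Type*} [MeasurableSpace 𝓧] {P Q : Measure 𝓧} {r r' : ℝ}
    (H : AffinityDualBound P Q r) (h : r' ≤ r) : AffinityDualBound P Q r' :=
  fun k a b hk ha hab => le_trans (by linarith) (H k a b hk ha hab)

/-- Test functions on the target pull back to the source. `T` need not be invertible, so degenerate
Gaussian marginals are covered. -/
lemma AffinityDualBound.map {𝓧 𝓨 : Type*} [MeasurableSpace 𝓧] [MeasurableSpace 𝓨]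
    {P Q : Measure 𝓧} {r : ℝ} (H : AffinityDualBound P Q r) {T : 𝓧 → 𝓨} (hT : Measurable T) :
    AffinityDualBound (P.map T) (Q.map T) r := by
  intro k a b hk ha hab
  rw [integral_map hT.aemeasurable hk.aestronglyMeasurable,
    integral_map (f := fun y => (k y)⁻¹) hT.aemeasurable hk.inv.aestronglyMeasurable]
  exact H _ a b (hk.comp hT) ha fun x => hab _

lemma affinityDualBound_pi_gaussianReal (v : ι → ℝ≥0) (hv : ∀ i, v i ≠ 0) :
    AffinityDualBound (Measure.pi fun _ : ι => gaussianReal 0 1)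
      (Measure.pi fun i => gaussianReal 0 (v i)) (1 - ∑ i, ((v i : ℝ) - 1) ^ 2) := by
  have h := AffinityDualBound.pi_withDensity (f := fun _ : ι => gaussianPDFReal 0 1)
    (g := fun i => gaussianPDFReal 0 (v i)) (fun _ => integrable_gaussianPDFReal _ _)
    (fun _ => measurable_gaussianPDFReal _ _) (fun _ => gaussianPDFReal_nonneg _ _)
    (fun _ => integrable_gaussianPDFReal _ _) (fun _ => measurable_gaussianPDFReal _ _)
    (fun _ => gaussianPDFReal_nonneg _ _)
  simp_rw [integral_sqrt_gaussianPDFReal (hv _)] at h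
  have e1 : gaussianReal 0 1 = (volume : Measure ℝ).withDensity
      fun x => ENNReal.ofReal (gaussianPDFReal 0 1 x) := gaussianReal_of_var_ne_zero _ one_ne_zero
  have e2 i : gaussianReal 0 (v i) = (volume : Measure ℝ).withDensity
      fun x => ENNReal.ofReal (gaussianPDFReal 0 (v i) x) := gaussianReal_of_var_ne_zero _ (hv i)
  simp_rw [e1, e2]
  exact h.mono (one_sub_sum_le_prod _ _ _ (fun i => one_sub_sq_le_affinity.1)
    (fun i => Real.sqrt_nonneg _) fun i => one_sub_sq_le_affinity.2)

end GaussianAffinity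

/-! ### Simultaneous diagonalization of quadratic forms -/

/-- Take `b₁` as inner product; then `b₂` is represented by a self-adjoint operator `A`, and an
orthonormal eigenbasis of `A` diagonalizes both forms. -/
lemma exists_basis_simultaneous_diagonal {E : Type*} [AddCommGroup E] [Module ℝ E]
    [FiniteDimensional ℝ E] (b₁ b₂ : LinearMap.BilinForm ℝ E) (h₁ : ∀ x y, b₁ x y = b₁ y x)
    (h₂ : ∀ x y, b₂ x y = b₂ y x) (hpos : ∀ x, x ≠ 0 → 0 < b₁ x x) :
    ∃ (n : ℕ) (e : Module.Basis (Fin n) ℝ E),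
      (∀ i j, b₁ (e i) (e j) = if i = j then 1 else 0) ∧ ∀ i j, i ≠ j → b₂ (e i) (e j) = 0 := by
  let core : InnerProductSpace.Core ℝ E :=
    { inner x y := b₁ x y
      conj_inner_symm x y := by simp [h₁ y x]
      re_inner_nonneg x := by
        rcases eq_or_ne x 0 with rfl | hx
        · simp
        · simpa using (hpos x hx).le
      add_left x y z := by simp
      smul_left x y r := by simp
      definite x hx := by
        by_contra h
        exact (hpos x h).ne' hx }
  let _ : NormedAddCommGroup E := core.toNormedAddCommGroup
  let _ : InnerProductSpace ℝ E := InnerProductSpace.ofCore core.toCore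
  have hinner (x y : E) : inner ℝ x y = b₁ x y := rfl
  have hnd : b₁.Nondegenerate := by
    refine ⟨fun x hx => ?_, fun x hx => ?_⟩ <;> by_contra h <;> exact (hpos x h).ne' (hx x)
  let A : E →ₗ[ℝ] E := (b₁.toDual hnd).symm.toLinearMap ∘ₗ b₂
  have hA x y : b₁ (A x) y = b₂ x y := 
    LinearMap.BilinForm.apply_toDual_symm_apply (hB := hnd) (b₂ x) y
  have hsymm : A.IsSymmetric := fun x y => by
    rw [hinner, hinner, hA, h₁ x, hA, h₂]
  let e := hsymm.eigenvectorBasis rfl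
  have horth i j : b₁ (e i) (e j) = if i = j then 1 else 0 :=
    orthonormal_iff_ite.1 e.orthonormal i j
  refine ⟨_, e.toBasis, ?_, ?_⟩
  · simpa using horth
  · intro i j hij
    have := hsymm.apply_eigenvectorBasis rfl i
    rw [e.coe_toBasis, ← hA]
    change b₁ (A (hsymm.eigenvectorBasis rfl i)) _ = 0
    rw [this]
    have h3 := horth i j
    rw [if_neg hij] at h3
    simp only [map_smul, LinearMap.smul_apply]
    rw [show b₁ (hsymm.eigenvectorBasis rfl i) (e j) = 0 from h3, smul_zero]

/-! ### The covariance form of the observation -/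

section Covariance

lemma integrable_coe (f : L2I) : Integrable f := (Lp.memLp f).integrable (by norm_num)

lemma tail_add (f g : L2I) (s : unitInterval) :
    tail (f + g : L2I) s = tail f s + tail g s := by
  rw [tail, tail, tail, ← integral_add (integrable_coe f).integrableOn
    (integrable_coe g).integrableOn]
  exact integral_congr_ae (ae_restrict_of_ae (Lp.coeFn_add f g))

lemma tail_smul (c : ℝ) (f : L2I) (s : unitInterval) : tail (c • f : L2I) s = c * tail f s := by
  rw [tail, tail, ← integral_const_mul]
  exact integral_congr_ae (ae_restrict_of_ae (Lp.coeFn_smul c f))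

/-- The tail integral at `s` as a linear functional. -/
def tailₗ (s : unitInterval) : L2I →ₗ[ℝ] ℝ where
  toFun f := tail f s
  map_add' f g := tail_add f g s
  map_smul' c f := tail_smul c f s

lemma integrable_of_continuous {u : unitInterval → ℝ} (hu : Continuous u) : Integrable u :=
  hu.integrable_of_hasCompactSupport (HasCompactSupport.of_compactSpace u)

lemma continuous_tail_coe (f : L2I) : Continuous (tail f) := continuous_tail (integrable_coe f)

/-- The bilinear form `(f, g) ↦ ∫ ρ (tail f) (tail g)`. -/
def tailForm (ρ : C(unitInterval, ℝ)) : LinearMap.BilinForm ℝ L2I :=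
  LinearMap.mk₂ ℝ (fun f g => ∫ s, ρ s * (tail f s * tail g s))
    (fun f f' g => by
      rw [← integral_add]
      · simp only [tail_add]
        congr with s
        ring
      all_goals
        have := continuous_tail_coe f
        have := continuous_tail_coe f'
        have := continuous_tail_coe g
        exact integrable_of_continuous (by fun_prop))
    (fun c f g => by
      rw [smul_eq_mul, ← integral_const_mul]
      simp only [tail_smul]
      congr with s
      ring)
    (fun f g g' => by
      rw [← integral_add]
      · simp only [tail_add]
        congr with s
        ring
      all_goals
        have := continuous_tail_coe f
        have := continuous_tail_coe g
        have := continuous_tail_coe g'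
        exact integrable_of_continuous (by fun_prop))
    (fun c f g => by
      rw [smul_eq_mul, ← integral_const_mul]
      simp only [tail_smul]
      congr with s
      ring)

lemma tailForm_apply (ρ : C(unitInterval, ℝ)) (f g : L2I) :
    tailForm ρ f g = ∫ s, ρ s * (tail f s * tail g s) := rfl

/-- The covariance `(f, g) ↦ ε² ⟪f, g⟫ + ∫ σ² (tail f) (tail g)` of the observation. -/
def covForm (σ : C(unitInterval, ℝ)) (ε : ℝ) : LinearMap.BilinForm ℝ L2I :=
  ε ^ 2 • (innerₗ L2I : LinearMap.BilinForm ℝ L2I) + tailForm (σ ^ 2)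

lemma covForm_apply (σ : C(unitInterval, ℝ)) (ε : ℝ) (f g : L2I) :
    covForm σ ε f g = ε ^ 2 * inner ℝ f g + tailForm (σ ^ 2) f g := rfl

lemma covForm_comm (σ : C(unitInterval, ℝ)) (ε : ℝ) (f g : L2I) :
    covForm σ ε f g = covForm σ ε g f := by
  simp only [covForm_apply, tailForm_apply, real_inner_comm g f, mul_comm (tail f _)]

lemma norm_sq_eq_integral_sq (f : L2I) : ‖f‖ ^ 2 = ∫ x, f x ^ 2 := by
  rw [integral_sq_eq_norm_toLp_sq (Lp.memLp f), Lp.toLp_coeFn]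

lemma covForm_self (σ : C(unitInterval, ℝ)) (ε : ℝ) (f : L2I) :
    covForm σ ε f f = (∫ s, (σ s * tail f s) ^ 2) + ε ^ 2 * ∫ x, f x ^ 2 := by
  rw [covForm_apply, tailForm_apply, real_inner_self_eq_norm_sq, norm_sq_eq_integral_sq, add_comm]
  congr 2 with s
  simp
  ring

lemma covForm_self_pos (σ : C(unitInterval, ℝ)) {ε : ℝ} (hε : 0 < ε) {f : L2I} (hf : f ≠ 0) :
    0 < covForm σ ε f f := by
  rw [covForm_self, ← norm_sq_eq_integral_sq]
  have h1 : 0 ≤ ∫ s, (σ s * tail f s) ^ 2 := integral_nonneg fun s => sq_nonneg _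
  have h2 : 0 < ‖f‖ := norm_pos_iff.2 hf
  positivity

/-- The noise term is common to both forms and cancels. -/
lemma covForm_sub_covForm (σ₁ σ₂ : C(unitInterval, ℝ)) (ε : ℝ) (f g : L2I) :
    covForm σ₂ ε f g - covForm σ₁ ε f g = tailForm (σ₂ ^ 2 - σ₁ ^ 2) f g := by
  have := continuous_tail_coe f
  have := continuous_tail_coe g
  rw [covForm_apply, covForm_apply, tailForm_apply, tailForm_apply, tailForm_apply,
    add_sub_add_left_eq_sub, ← integral_sub (integrable_of_continuous (by fun_prop))
      (integrable_of_continuous (by fun_prop))]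
  congr with s
  simp
  ring

lemma abs_tailForm_self_le (ρ : C(unitInterval, ℝ)) (f : L2I) :
    |tailForm ρ f f| ≤ ‖ρ‖ * ∫ s, tail f s ^ 2 := by
  have := continuous_tail_coe f
  rw [tailForm_apply, ← integral_const_mul]
  refine (abs_integral_le_integral_abs).trans (integral_mono
    (integrable_of_continuous (by fun_prop)) (integrable_of_continuous (by fun_prop)) fun s => ?_)
  simp only
  rw [← sq, abs_mul, abs_of_nonneg (sq_nonneg (tail f s))]
  exact mul_le_mul_of_nonneg_right (ρ.norm_coe_le_norm s) (sq_nonneg _)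

/-- The left side is the numerator of `tail_sq_le` with weights `a = ε` and `b = m`, so point values
of the tail are controlled by the covariance form. -/
lemma sq_mul_integral_add_le_covForm {σ : C(unitInterval, ℝ)} {ε m : ℝ} (hm : 0 < m)
    (hσ : ∀ t, m ≤ σ t) (f : L2I) :
    ε ^ 2 * (∫ x, f x ^ 2) + m ^ 2 * (∫ s, tail f s ^ 2) ≤ covForm σ ε f f := by
  have := continuous_tail_coe f
  rw [covForm_self, add_comm, ← integral_const_mul]
  refine add_le_add_left (integral_mono (integrable_of_continuous (by fun_prop))
    (integrable_of_continuous (by fun_prop)) fun s => ?_) _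
  simp only [mul_pow]
  exact mul_le_mul_of_nonneg_right (pow_le_pow_left₀ hm.le (hσ s) 2) (sq_nonneg _)

/-- For a family that is orthonormal with respect to the covariance form of `σ₁`, the sum of the
squared diagonal perturbations is bounded. -/
lemma sum_covForm_sub_one_sq_le {σ₁ σ₂ : C(unitInterval, ℝ)} {ε m : ℝ} (hε : 0 < ε) (hm : 0 < m)
    (hσ : ∀ t, m ≤ σ₁ t) {ι : Type*} [Fintype ι] [DecidableEq ι] (e : ι → L2I)
    (he : ∀ i j, covForm σ₁ ε (e i) (e j) = if i = j then 1 else 0) :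
    ∑ i, (covForm σ₂ ε (e i) (e i) - 1) ^ 2 ≤ ‖σ₁ ^ 2 - σ₂ ^ 2‖ ^ 2 * (m⁻¹) ^ 3 * ε⁻¹ := by
  have hsq i : Integrable fun s => tail (e i) s ^ 2 :=
    integrable_of_continuous ((continuous_tail_coe (e i)).pow 2)
  have hI i : 0 ≤ ∫ s, tail (e i) s ^ 2 := integral_nonneg fun s => sq_nonneg _
  have h1 i : ∫ s, tail (e i) s ^ 2 ≤ (m⁻¹) ^ 2 := by
    have h2 := sq_mul_integral_add_le_covForm (ε := ε) hm hσ (e i)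
    rw [he, if_pos rfl] at h2
    have h3 : 0 ≤ ∫ x, e i x ^ 2 := integral_nonneg fun s => sq_nonneg _
    rw [inv_pow, ← one_div, le_div_iff₀ (by positivity)]
    nlinarith [mul_nonneg (sq_nonneg ε) h3]
  -- `g` represents evaluation of the tail at `s` on the span of the `e i`, so `tail g s = covForm
  -- σ₁ ε g g = N`. Interpolation then reads `N² ≤ N / (ε m)`.
  have h4 (s : unitInterval) : ∑ i, tail (e i) s ^ 2 ≤ (ε * m)⁻¹ := by
    set N := ∑ i, tail (e i) s ^ 2 with hN
    set g : L2I := ∑ i, tail (e i) s • e i with hg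
    have hN0 : 0 ≤ N := Finset.sum_nonneg fun i _ => sq_nonneg _
    have h5 : tail g s = N := by
      change tailₗ s g = N
      rw [hg, map_sum]
      refine Finset.sum_congr rfl fun i _ => ?_
      rw [map_smul, smul_eq_mul, sq]
      rfl
    have h6 : covForm σ₁ ε g g = N := by
      simp only [hg, map_sum, LinearMap.sum_apply, map_smul, LinearMap.smul_apply, he, smul_eq_mul,
        mul_ite, mul_one, mul_zero, Finset.sum_ite_eq', Finset.mem_univ, if_true]
      exact Finset.sum_congr rfl fun i _ => (sq _).symm
    have h7 := tail_sq_le (Lp.memLp g) hε hm s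
    have h8 := sq_mul_integral_add_le_covForm (ε := ε) hm hσ g
    rw [h6] at h8
    rw [h5, le_div_iff₀ (by positivity)] at h7
    rw [← one_div, le_div_iff₀ (by positivity)]
    rcases hN0.eq_or_lt with h | h
    · rw [← h]
      simp
    · have : N * (N * (ε * m)) ≤ N * 1 := by nlinarith
      exact le_of_mul_le_mul_left this h
  have h9 : ∑ i, ∫ s, tail (e i) s ^ 2 ≤ (ε * m)⁻¹ := by
    rw [← integral_finsetSum _ fun i _ => hsq i]
    calc ∫ s, ∑ i, tail (e i) s ^ 2 ≤ ∫ _ : unitInterval, (ε * m)⁻¹ :=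
          integral_mono (integrable_finsetSum _ fun i _ => hsq i) (integrable_const _) h4
      _ = (ε * m)⁻¹ := by simp
  set δ := ‖σ₁ ^ 2 - σ₂ ^ 2‖ with hδ
  -- Of the two factors `∫ (tail (e i))²`, one is bounded by `m⁻²`; the other is kept, to be summed
  -- with the kernel bound.
  have h10 i : (covForm σ₂ ε (e i) (e i) - 1) ^ 2 ≤
      δ ^ 2 * (m⁻¹) ^ 2 * ∫ s, tail (e i) s ^ 2 := by
    have h11 := covForm_sub_covForm σ₁ σ₂ ε (e i) (e i)
    rw [he, if_pos rfl] at h11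
    have h12 := abs_tailForm_self_le (σ₂ ^ 2 - σ₁ ^ 2) (e i)
    rw [← h11, norm_sub_rev, ← hδ] at h12
    rw [← sq_abs]
    calc |covForm σ₂ ε (e i) (e i) - 1| ^ 2 ≤ (δ * ∫ s, tail (e i) s ^ 2) ^ 2 :=
          pow_le_pow_left₀ (abs_nonneg _) h12 2
      _ = δ ^ 2 * (∫ s, tail (e i) s ^ 2) * ∫ s, tail (e i) s ^ 2 := by ring
      _ ≤ _ := by
          refine mul_le_mul_of_nonneg_right (mul_le_mul_of_nonneg_left (h1 i) (sq_nonneg _)) (hI i)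
  calc ∑ i, (covForm σ₂ ε (e i) (e i) - 1) ^ 2
      ≤ ∑ i, δ ^ 2 * (m⁻¹) ^ 2 * ∫ s, tail (e i) s ^ 2 := Finset.sum_le_sum fun i _ => h10 i
    _ = δ ^ 2 * (m⁻¹) ^ 2 * ∑ i, ∫ s, tail (e i) s ^ 2 := by rw [Finset.mul_sum]
    _ ≤ δ ^ 2 * (m⁻¹) ^ 2 * (ε * m)⁻¹ := by gcongr
    _ = δ ^ 2 * (m⁻¹) ^ 3 * ε⁻¹ := by rw [mul_inv]; ring

end Covariance

/-! ### The law of the observation -/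

section Law

variable {σ : C(unitInterval, ℝ)} {ε : ℝ} {Q : Measure (L2I → ℝ)}

lemma IsObservationLaw.isProbabilityMeasure (hQ : IsObservationLaw.{u} σ ε Q) :
    IsProbabilityMeasure Q := by
  obtain ⟨Ω, _, P, B, W, X, Y, h, rfl⟩ := hQ
  have hB := h.brownian_B.toIsPreBrownianReal
  have : IsProbabilityMeasure P := hB.isGaussianProcess.isProbabilityMeasure
  exact Measure.isProbabilityMeasure_map (measurable_pi_lambda _ h.measurable_obs).aemeasurable

lemma IsObservationLaw.integral_cexp_sum (hQ : IsObservationLaw.{u} σ ε Q) {ι : Type*} [Fintype ι]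
    (a : ι → ℝ) (g : ι → L2I) :
    ∫ y, Complex.exp (Complex.I * ((∑ i, a i * y (g i) : ℝ) : ℂ)) ∂Q =
      Complex.exp (-((covForm σ ε (∑ i, a i • g i) (∑ i, a i • g i) : ℝ) : ℂ) / 2) := by
  obtain ⟨Ω, _, P, B, W, X, Y, h, rfl⟩ := hQ
  rw [integral_map (measurable_pi_lambda _ h.measurable_obs).aemeasurable
    (Measurable.aestronglyMeasurable (by fun_prop)), covForm_self]
  exact h.integral_cexp_sum a g

/-- The observation is almost surely linear in the test function. -/
lemma IsObservationLaw.ae_eq_sum (hQ : IsObservationLaw.{u} σ ε Q) {ι : Type*} [Fintype ι]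
    {f : L2I} (a : ι → ℝ) (g : ι → L2I) (hf : f = ∑ i, a i • g i) :
    ∀ᵐ y ∂Q, y f = ∑ i, a i * y (g i) := by
  have := hQ.isProbabilityMeasure
  set D : (L2I → ℝ) → ℝ := fun y => y f - ∑ i, a i * y (g i) with hD
  have hm : Measurable D := by fun_prop
  -- `D` evaluates a combination of test functions that is zero in `L²`, so its characteristic
  -- function is identically 1. The index `none` carries `f`, the others the `g i`.
  have h1 : Q.map D = Measure.dirac 0 := by
    refine Measure.ext_of_charFun (funext fun t => ?_)
    rw [charFun_dirac, charFun_apply_real, integral_map hm.aemeasurable (by fun_prop)]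
    have h2 := hQ.integral_cexp_sum (ι := Option ι) (fun i => i.elim t fun i => -(t * a i))
      (fun i => i.elim f g)
    have h3 : ∑ i : Option ι, (i.elim t fun i => -(t * a i)) • (i.elim f g : L2I) = 0 := by
      simp [Fintype.sum_option, hf, Finset.smul_sum, mul_smul]
    rw [h3] at h2
    simp only [map_zero, Complex.ofReal_zero, neg_zero, zero_div, Complex.exp_zero,
      inner_zero_left, zero_mul] at h2 ⊢
    rw [← h2]
    congr with y
    congr 1
    simp only [Fintype.sum_option, Option.elim, hD]
    push_cast
    simp only [neg_mul, Finset.sum_neg_distrib, mul_assoc, ← Finset.mul_sum]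
    ring
  have h4 : HasLaw D (Measure.dirac 0) Q := ⟨hm.aemeasurable, h1⟩
  filter_upwards [h4.ae_eq_of_dirac] with y hy
  exact sub_eq_zero.1 hy

/-- In directions that diagonalize the covariance, the observation has independent Gaussian
coordinates. -/
lemma IsObservationLaw.map_eval_eq_pi (hQ : IsObservationLaw.{u} σ ε Q) {ι : Type*} [Fintype ι]
    (e : ι → L2I) (v : ι → ℝ≥0) (he : ∀ i j, i ≠ j → covForm σ ε (e i) (e j) = 0)
    (hv : ∀ i, covForm σ ε (e i) (e i) = v i) :
    Q.map (fun y i => y (e i)) = Measure.pi fun i => gaussianReal 0 (v i) := by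
  classical
  have := hQ.isProbabilityMeasure
  have hm : Measurable fun (y : L2I → ℝ) (i : ι) => y (e i) := by fun_prop
  have : IsProbabilityMeasure (Q.map fun y i => y (e i)) :=
    Measure.isProbabilityMeasure_map hm.aemeasurable
  refine charFun_eq_pi_iff.1 fun t => ?_
  rw [charFun_apply, integral_map (by fun_prop) (by fun_prop),
    integral_map hm.aemeasurable (by fun_prop)]
  have h1 := hQ.integral_cexp_sum t e
  have h2 : covForm σ ε (∑ i, t i • e i) (∑ i, t i • e i) = ∑ i, t i ^ 2 * v i := by
    have h3 i j : covForm σ ε (e i) (e j) = if i = j then (v i : ℝ) else 0 := by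
      split_ifs with h
      · rw [h, hv]
      · exact he i j h
    simp only [map_sum, LinearMap.sum_apply, map_smul, LinearMap.smul_apply, h3, smul_eq_mul,
      mul_ite, mul_zero, Finset.sum_ite_eq', Finset.mem_univ, if_true]
    exact Finset.sum_congr rfl fun i _ => by ring
  rw [h2] at h1
  simp only [charFun_gaussianReal, ← Complex.exp_sum]
  convert h1 using 1
  · congr with y
    congr 1
    rw [mul_comm]
    simp [PiLp.inner_apply, mul_comm]
  · congr 1
    push_cast
    rw [neg_div, Finset.sum_div, ← Finset.sum_neg_distrib]
    exact Finset.sum_congr rfl fun i _ => by ring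

end Law

/-! ### The Hellinger bound -/

section Bound

variable {σ₁ σ₂ : C(unitInterval, ℝ)} {ε m : ℝ} {Q₁ Q₂ : Measure (L2I → ℝ)}

/-- The functions in `I` may be linearly dependent, so the marginals may have no density. In a
diagonalizing basis of their span the laws are nondegenerate Gaussian products, and both marginals
are images of these under one linear map. -/
lemma affinityDualBound_map_restrict (h₁ : IsObservationLaw.{u} σ₁ ε Q₁)
    (h₂ : IsObservationLaw.{v} σ₂ ε Q₂) (hε : 0 < ε) (hm : 0 < m) (hσ : ∀ t, m ≤ σ₁ t)
    (I : Finset L2I) :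
    AffinityDualBound (Q₁.map I.restrict) (Q₂.map I.restrict)
      (1 - ‖σ₁ ^ 2 - σ₂ ^ 2‖ ^ 2 * (m⁻¹) ^ 3 * ε⁻¹) := by
  set V : Submodule ℝ L2I := Submodule.span ℝ (I : Set L2I) with hV
  have : FiniteDimensional ℝ V := FiniteDimensional.span_finset ℝ I
  obtain ⟨n, e, he₁, he₂⟩ := exists_basis_simultaneous_diagonal
    ((covForm σ₁ ε).restrict V) ((covForm σ₂ ε).restrict V)
    (fun x y => covForm_comm σ₁ ε x y) (fun x y => covForm_comm σ₂ ε x y)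
    (fun x hx => covForm_self_pos σ₁ hε (by simpa using hx))
  have hpos i : 0 < covForm σ₂ ε (e i) (e i) :=
    covForm_self_pos σ₂ hε (by simpa using e.ne_zero i)
  -- `T` rebuilds the values on `I` from those on the basis; almost sure linearity of the
  -- observation makes this exact up to null sets. It depends on neither law.
  let T : (Fin n → ℝ) → (I → ℝ) := fun z f =>
    ∑ k, e.repr ⟨f, Submodule.subset_span f.2⟩ k * z k
  have hT : Measurable T := by fun_prop
  have hmap {Q : Measure (L2I → ℝ)}
      (h : ∀ f ∈ I, ∀ (a : Fin n → ℝ), f = ∑ k, a k • (e k : L2I) →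
        ∀ᵐ y ∂Q, y f = ∑ k, a k * y (e k)) :
      Q.map I.restrict = (Q.map fun y k => y (e k : L2I)).map T := by
    rw [Measure.map_map hT (by fun_prop)]
    refine Measure.map_congr ?_
    have h' : ∀ᵐ y ∂Q, ∀ f : I, y f = ∑ k, e.repr ⟨f, Submodule.subset_span f.2⟩ k * y (e k) := by
      refine ae_all_iff.2 fun f => h f f.2 _ ?_
      have := congrArg Subtype.val (e.sum_repr ⟨f, Submodule.subset_span f.2⟩)
      rw [Submodule.coe_sum] at this
      exact this.symm
    filter_upwards [h'] with y hy
    ext f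
    exact hy f
  have e₁ : Q₁.map I.restrict = (Measure.pi fun _ : Fin n => gaussianReal 0 1).map T := by
    rw [hmap fun f _ a hf => h₁.ae_eq_sum a _ hf,
      h₁.map_eval_eq_pi (fun k => (e k : L2I)) (fun _ => 1)
        (fun i j hij => (he₁ i j).trans (if_neg hij))
        (fun i => (he₁ i i).trans (by simp))]
  have e₂ : Q₂.map I.restrict = (Measure.pi fun i : Fin n =>
      gaussianReal 0 (covForm σ₂ ε (e i) (e i)).toNNReal).map T := by
    rw [hmap fun f _ a hf => h₂.ae_eq_sum a _ hf,
      h₂.map_eval_eq_pi (fun k => (e k : L2I)) (fun i => (covForm σ₂ ε (e i) (e i)).toNNReal)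
        (fun i j hij => he₂ i j hij)
        (fun i => (Real.coe_toNNReal _ (hpos i).le).symm)]
  rw [e₁, e₂]
  refine ((affinityDualBound_pi_gaussianReal _ fun i => ?_).map hT).mono ?_
  · simpa using hpos i
  · have := sum_covForm_sub_one_sq_le (σ₂ := σ₂) hε hm hσ (fun i => (e i : L2I)) he₁
    simp only [Real.coe_toNNReal _ (hpos _).le]
    linarith

lemma hellingerDist_le (h₁ : IsObservationLaw.{u} σ₁ ε Q₁) (h₂ : IsObservationLaw.{v} σ₂ ε Q₂)
    (hε : 0 < ε) (hm : 0 < m) (hσ : ∀ t, m ≤ σ₁ t) :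
    hellingerDist Q₁ Q₂ ≤
      √2 * ‖σ₁ ^ 2 - σ₂ ^ 2‖ * m ^ (-(3 / 2) : ℝ) * ε ^ (-(1 / 2) : ℝ) := by
  have := h₁.isProbabilityMeasure
  have := h₂.isProbabilityMeasure
  refine (AffinityDualBound.of_restrict
    (affinityDualBound_map_restrict h₁ h₂ hε hm hσ)).hellingerDist_le.trans ?_
  rw [Real.sqrt_le_left (by positivity), mul_pow, mul_pow, mul_pow, Real.sq_sqrt zero_le_two,
    ← Real.rpow_mul_natCast hm.le, ← Real.rpow_mul_natCast hε.le]
  have e1 : (-(3 / 2) : ℝ) * (2 : ℕ) = ((-3 : ℤ) : ℝ) := by norm_num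
  have e2 : (-(1 / 2) : ℝ) * (2 : ℕ) = ((-1 : ℤ) : ℝ) := by norm_num
  rw [e1, e2, Real.rpow_intCast, Real.rpow_intCast, zpow_neg_one, zpow_neg, inv_pow]
  norm_cast
  linarith

lemma exists_pos_le_of_pos {σ : C(unitInterval, ℝ)} (h : ∀ t, 0 < σ t) :
    ∃ t₀, 0 < σ t₀ ∧ ∀ t, σ t₀ ≤ σ t := by
  obtain ⟨t₀, -, ht₀⟩ := isCompact_univ.exists_isMinOn Set.univ_nonempty σ.continuous.continuousOn
  exact ⟨t₀, h t₀, fun t => ht₀ (Set.mem_univ t)⟩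

lemma rpow_neg_le_iSup {σ : C(unitInterval, ℝ)} {t₀ : unitInterval} (h0 : 0 < σ t₀)
    (h : ∀ t, σ t₀ ≤ σ t) {p : ℝ} (hp : p ≤ 0) : σ t₀ ^ p ≤ ⨆ t, σ t ^ p :=
  -- A real supremum over an unbounded range defaults to 0, so boundedness must be given; the bound
  -- is the value at the minimizer `t₀`.
  le_ciSup (f := fun t => σ t ^ p) ⟨σ t₀ ^ p, by
    rintro _ ⟨t, rfl⟩
    exact Real.rpow_le_rpow_of_nonpos h0 (h t) hp⟩ t₀

end Bound

end WhiteNoise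
end

/-! ### Both bounds, from the estimate in terms of `min σ₁` -/

theorem propositionA1 :
    -- one universal constant, with the scaling-invariant exponent `-3/2`
    (∃ C : ℝ, 0 < C ∧
      ∀ (σ₁ σ₂ : C(unitInterval, ℝ)) (ε : ℝ), (∀ t, 0 < σ₁ t) → (∀ t, 0 < σ₂ t) → 0 < ε →
      ∀ Q₁ Q₂ : Measure (WhiteNoise.L2I → ℝ),
        WhiteNoise.IsObservationLaw.{u} σ₁ ε Q₁ → WhiteNoise.IsObservationLaw.{v} σ₂ ε Q₂ →
      WhiteNoise.hellingerDist Q₁ Q₂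
        ≤ C * ‖σ₁ ^ 2 - σ₂ ^ 2‖ * (⨆ t, (σ₁ t) ^ (-(3 / 2) : ℝ)) * ε ^ (-(1 / 2) : ℝ)) ∧
    -- exponent `-3`, with a constant that is uniform over `min σ₁ ≤ M`
    (∀ M : ℝ, 0 < M → ∃ C : ℝ, 0 < C ∧
      ∀ (σ₁ σ₂ : C(unitInterval, ℝ)) (ε : ℝ), (∀ t, 0 < σ₁ t) → (∀ t, 0 < σ₂ t) → 0 < ε →
      (∃ t, σ₁ t ≤ M) →
      ∀ Q₁ Q₂ : Measure (WhiteNoise.L2I → ℝ),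
        WhiteNoise.IsObservationLaw.{u} σ₁ ε Q₁ → WhiteNoise.IsObservationLaw.{v} σ₂ ε Q₂ →
      WhiteNoise.hellingerDist Q₁ Q₂
        ≤ C * ‖σ₁ ^ 2 - σ₂ ^ 2‖ * (⨆ t, (σ₁ t) ^ (-3 : ℝ)) * ε ^ (-(1 / 2) : ℝ)) := by
  refine ⟨⟨√2, by positivity, ?_⟩, fun M hM => ⟨√2 * M ^ (3 / 2 : ℝ), by positivity, ?_⟩⟩
  · intro σ₁ σ₂ ε hσ₁ _ hε Q₁ Q₂ h₁ h₂
    obtain ⟨t₀, h0, ht₀⟩ := WhiteNoise.exists_pos_le_of_pos hσ₁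
    refine (WhiteNoise.hellingerDist_le h₁ h₂ hε h0 ht₀).trans ?_
    gcongr
    exact WhiteNoise.rpow_neg_le_iSup h0 ht₀ (by norm_num)
  · rintro σ₁ σ₂ ε hσ₁ _ hε ⟨t, ht⟩ Q₁ Q₂ h₁ h₂
    obtain ⟨t₀, h0, ht₀⟩ := WhiteNoise.exists_pos_le_of_pos hσ₁
    refine (WhiteNoise.hellingerDist_le h₁ h₂ hε h0 ht₀).trans ?_
    -- Split `m^(-3/2) = m^(3/2) · m^(-3)` at the minimum `m = σ₁ t₀`, which is at most `M`; this is
    -- where the factor `M^(3/2)` in the constant comes from.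
    have h3 : σ₁ t₀ ^ (-(3 / 2) : ℝ) ≤ M ^ (3 / 2 : ℝ) * ⨆ t, (σ₁ t) ^ (-3 : ℝ) :=
      calc σ₁ t₀ ^ (-(3 / 2) : ℝ) = σ₁ t₀ ^ (3 / 2 : ℝ) * σ₁ t₀ ^ (-3 : ℝ) := by
            rw [← Real.rpow_add h0]
            norm_num
        _ ≤ M ^ (3 / 2 : ℝ) * ⨆ t, (σ₁ t) ^ (-3 : ℝ) := by
            gcongr
            · exact (ht₀ t).trans ht
            · exact WhiteNoise.rpow_neg_le_iSup h0 ht₀ (by norm_num)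
    calc √2 * ‖σ₁ ^ 2 - σ₂ ^ 2‖ * σ₁ t₀ ^ (-(3 / 2) : ℝ) * ε ^ (-(1 / 2) : ℝ)
        ≤ √2 * ‖σ₁ ^ 2 - σ₂ ^ 2‖ * (M ^ (3 / 2 : ℝ) * ⨆ t, (σ₁ t) ^ (-3 : ℝ)) *
          ε ^ (-(1 / 2) : ℝ) := by gcongr
      _ = _ := by ring
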